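/- **Setting.** Let $M$ be a compact Riemannian manifold (without boundary, connected, with Riemannian distance $\|x-y\|$). Fix $0<\nu<1$ and $0\le\alpha\le 1$. For $d\ge 2$ let $\Sigma_d=\{1,\dots,d\}^{\mathbb Z}$, let $\tau$ be the shift $(\tau\xi)_i=\xi_{i+1}$, and let $d_{\Sigma_d}(\xi,\zeta)=\nu^{\ell}$, $\ell=\min\{i\ge 0:\xi_i\ne\zeta_i\text{ or }\xi_{-i}\neq\zeta_{-i}\}$ for $\xi\ne\zeta$. Put $W^s_{loc}(\xi;\tau)=\{\zeta:\zeta_i=\xi_i,\ i\ge0\}$ and $W^u_{loc}(\xi;\tau)=\{\zeta:\zeta_i=\xi_i,\ i\le0\}$. A skew-product $\Phi=\tau\times\phi_\xi$ on $\Sigma_d\times M$ is a map $\Phi(\xi,x)=(\tau\xi,\phi_\xi(x))$ with homeomorphisms $\phi_\xi$ of $M$ depending continuously on $\xi$; it is one-step, $\Phi=\tau\times(\phi_1,\dots,\phi_d)$, if $\phi_\xi=\phi_{\xi_0}$. Write $\phi^n_\xi=\phi_{\tau^{n-1}\xi}\circ\dots\circ\phi_\xi$. A map $\phi$ is $(\lambda,\beta)$-Lipschitz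 on a set $X$ if $\lambda\|x-y\|<\|\phi(x)-\phi(y)\|<\beta\|x-y\|$ for all distinct $x,y\in X$. For $D\subset M$ bounded and open and $0<\lambda<\beta$, $\mathcal S^{r,\alpha}_{d,\lambda,\beta}(D)$ ($r=0,1$) is the set of such $\Phi$ for which every $\phi_\xi^{\pm1}$ is $C^r$, every $\phi_\xi$ is $(\lambda,\beta)$-Lipschitz on $\overline D$, and there is $C\ge0$ with $\|\phi_\xi^{\pm1}(x)-\phi_\zeta^{\pm1}(x)\|\le C\,d_{\Sigma_d}(\xi,\zeta)^\alpha$ for all $x\in\overline D$ and all $\xi,\zeta$ with $\xi_0=\zeta_0$ (the least such $C$ is $C_\Phi$); moreover $\phi_\xi(\overline D)\subset D$ for all $\xi$ if $\beta<1$, and $\overline D\subset\phi_\xi(D)$ for all $\xi$ if $\lambda>1$. Its distance is $\sup_\xi d_{C^r}(\phi_\xi,\psi_\xi)+|C_\Phi-C_\Psi|$, with $d_{C^r}$ taken over $\overline D$. $\mathcal{PHS}^{r,\alpha}_{d,\lambda,\beta}(M)$ is the set of $\Phi\in\mathcal S^{r,\alpha}_{d,\lambda,\beta}(M)$ with $\nu^\alpha<\lambda<1<\beta<\nu^{-\alpha}$.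 "Every small enough $\mathcal S^{1,\alpha}$-perturbation of $\Phi$" means every $\Psi\in\bigcup_{0<\lambda<\beta}\mathcal S^{1,\alpha}_{d,\lambda,\beta}(M)$ sufficiently close to $\Phi$ for the distance with $r=1$ and $D=M$. The maximal invariant set of $\Phi$ in $\Sigma_d\times\overline D$ is $\Gamma_\Phi(D)=\bigcap_{n\in\mathbb Z}\Phi^n(\Sigma_d\times\overline D)$. The local strong unstable set $W^{uu}_{loc}((\xi,x);\Phi)$ is the set of $(\xi',x')$ with $\xi'\in W^u_{loc}(\xi;\tau)$ and $x'=\lim_{n\to\infty}\phi^n_{\tau^{-n}\xi'}\big((\phi^n_{\tau^{-n}\xi})^{-1}(x)\big)$, and $W^{uu}_{loc}(\Gamma;\Phi)$ is the union over the points of $\Gamma$. A $\delta$-horizontal disk in $\Sigma_d\times B$ is the graph of a map $h:W^s_{loc}(\zeta;\tau)\to B$ that is $\alpha$-Hölder with some constant $C\ge 0$, $C\nu^\alpha<\delta$, and satisfies $\|z-h(\xi)\|<\delta$ for all $\xi$, for some $(\zeta,z)\in\Sigma_d\times B$. For $\beta<1$ and $\alpha>0$, $\Gamma_\Phi(D)$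 is a *symbolic cs-blender-horseshoe* of $\Phi\in\mathcal S^{0,\alpha}_{d,\lambda,\beta}(D)$ with superposition domain the non-empty open set $B\subset D$ if there are $\delta>0$ and a neighbourhood $\mathcal V$ of $\Phi$ in $\mathcal S^{0,\alpha}_{d,\lambda,\beta}(D)$ such that $W^{uu}_{loc}(\Gamma_\Psi(D);\Psi)$ meets every $\delta$-horizontal disk in $\Sigma_d\times B$ for every $\Psi\in\mathcal V$. For $\lambda>1$, $\Gamma_\Phi(D)$ is a *symbolic cu-blender-horseshoe* of $\Phi\in\mathcal S^{0,\alpha}_{d,\lambda,\beta}(D)$ with superposition domain $B$ if the inverse skew-product $\Phi^*=\tau\times\phi^{-1}_{\xi^*}\in\mathcal S^{0,\alpha}_{d,\beta^{-1},\lambda^{-1}}(D)$, $\xi^*_i=\xi_{-i}$, has a symbolic cs-blender-horseshoe in $\Sigma_d\times\overline D$ with superposition domain $B$. $W^s(\Gamma;\Phi)$ and $W^u(\Gamma;\Phi)$ are the sets of points whose distance to $\Gamma$ under $\Phi^n$, respectively $\Phi^{-n}$, tends to $0$ as $n\to\infty$. $\Phi$ has a *symbolic cycle* associated with $\Phi$-invariant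 sets $\Gamma_1,\Gamma_2$ if $W^s(\Gamma_1;\Phi)\cap W^u(\Gamma_2;\Phi)\ne\emptyset$ and $W^u(\Gamma_1;\Phi)\cap W^s(\Gamma_2;\Phi)\neq\emptyset$. **Theorem.** Let $\phi_1,\dots,\phi_{k+2}$ be $(\gamma,\hat\gamma^{-1})$-Lipschitz $C^1$-diffeomorphisms of $M$, and let $D_{cs},D_{cu}\subset M$ be disjoint open sets such that $$\Phi=\tau\times(\phi_1,\dots,\phi_k)\in\mathcal S^{1,\alpha}_{k,\lambda_{cs},\beta_{cs}}(D_{cs})\cap\mathcal S^{1,\alpha}_{k,\lambda_{cu},\beta_{cu}}(D_{cu}),$$ $$\nu^\alpha<\gamma\le\lambda_{cs}<\beta_{cs}<1<\lambda_{cu}<\beta_{cu}\le\hat\gamma^{-1}<\nu^{-\alpha}.$$ Assume that there are open sets $B_{cs}\subset D_{cs}$, $B_{cu}\subset D_{cu}$ such that - (covering) $\overline{B_{cs}}\subset\bigcup_{i=1}^k\phi_i(B_{cs})$ and $\overline{B_{cu}}\subset\bigcup_{i=1}^k\phi_i^{-1}(B_{cu})$; - (cyclic transitions) there are $x\in B_{cs}$,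 $y\in B_{cu}$ and $n,m>0$ with $\phi_{k+1}^n(x)\in B_{cu}$ and $\phi_{k+2}^m(y)\in B_{cs}$. Then the one-step map $\hat\Phi=\tau\times(\phi_1,\dots,\phi_{k+2})$ belongs to $\mathcal{PHS}^{1,\alpha}_{k+2,\gamma,\hat\gamma^{-1}}(M)$ and has an $\mathcal S^{1,\alpha}$-robust symbolic cycle associated with symbolic blenders whose superposition domains contain $B_{cs}$ and $B_{cu}$. That is, for a skew-product $\Psi$ on $\Sigma_{k+2}\times M$ let $\Gamma^{cs}_\Psi,\Gamma^{cu}_\Psi\subset\Sigma_k\times M\subset\Sigma_{k+2}\times M$ be the maximal invariant sets of $\Psi|_{\Sigma_k\times M}$ in $\Sigma_k\times\overline{D_{cs}}$ and $\Sigma_k\times\overline{D_{cu}}$. Then $\Gamma^{cs}_{\hat\Phi}$ is a symbolic cs-blender-horseshoe and $\Gamma^{cu}_{\hat\Phi}$ a symbolic cu-blender-horseshoe of $\Phi$, for the constants $\lambda_{cs},\beta_{cs}$ and $\lambda_{cu},\beta_{cu}$, with superposition domains $B_{cs}$ and $B_{cu}$; and $\hat\Phi$, as well as every small enough $\mathcal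 S^{1,\alpha}$-perturbation $\Psi$ of $\hat\Phi$, has a symbolic cycle associated with the invariant sets $\Gamma^{cs}_\Psi$ and $\Gamma^{cu}_\Psi$, these being again a symbolic cs- and a symbolic cu-blender-horseshoe of $\Psi|_{\Sigma_k\times M}$ (for some constants $\lambda,\beta$, which may depend on $\Psi$) with superposition domains $B_{cs}$ and $B_{cu}$. -/

import Mathlib

open Set Filter Topology Bundle
open scoped Manifold ContDiff ENNReal

namespace SymbolicSkew

/-- The space `Σ_d` of bi-infinite sequences in `d` symbols (the symbols are `0, …, d - 1`). -/
abbrev Seq (d : ℕ) : Type := ℤ → Fin d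

/-- The shift `τ`, `(τ ξ)_i = ξ_{i+1}`. -/
def shift (d : ℕ) : Equiv.Perm (Seq d) where
  toFun ξ := fun i => ξ (i + 1)
  invFun ξ := fun i => ξ (i - 1)
  left_inv ξ := by funext i; simp
  right_inv ξ := by funext i; simp

/-- The conjugate sequence `ξ*`, `ξ*_i = ξ_{-i}`. -/
def conjSeq {d : ℕ} (ξ : Seq d) : Seq d := fun i => ξ (-i)

open Classical in
/-- `d_Σ(ξ, ζ) = ν ^ ℓ` with `ℓ = min {i ≥ 0 : ξ_i ≠ ζ_i or ξ_{-i} ≠ ζ_{-i}}`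
(and `0` if `ξ = ζ`). -/
noncomputable def seqDist {d : ℕ} (ν : ℝ) (ξ ζ : Seq d) : ℝ :=
  if ξ = ζ then 0
  else ν ^ sInf {i : ℕ | ξ (i : ℤ) ≠ ζ (i : ℤ) ∨ ξ (-(i : ℤ)) ≠ ζ (-(i : ℤ))}

/-- `W^s_loc(ξ; τ)`. -/
def stableSeq {d : ℕ} (ξ : Seq d) : Set (Seq d) := {ζ | ∀ i : ℤ, 0 ≤ i → ζ i = ξ i}

/-- `W^u_loc(ξ; τ)`. -/
def unstableSeq {d : ℕ} (ξ : Seq d) : Set (Seq d) := {ζ | ∀ i : ℤ, i ≤ 0 → ζ i = ξ i}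

/-- The data of a symbolic skew-product `Φ(ξ, x) = (τ ξ, φ_ξ x)` on `Σ_d × M`: fibre
homeomorphisms `φ_ξ` of `M` depending continuously on `ξ`. Smoothness of the fibre maps
is imposed in `MemS`. -/
structure SkewProduct (d : ℕ) (M : Type*) [TopologicalSpace M] where
  fib : Seq d → M ≃ₜ M
  continuous_fib : Continuous fun p : Seq d × M => fib p.1 p.2
  continuous_fib_symm : Continuous fun p : Seq d × M => (fib p.1).symm p.2

namespace SkewProduct

section Topological

variable {d : ℕ} {M : Type*} [TopologicalSpace M]

/-- The skew-product as a bijection of `Σ_d × M`. Its integer powers are the iterates. -/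
def map (Φ : SkewProduct d M) : Equiv.Perm (Seq d × M) where
  toFun p := (shift d p.1, Φ.fib p.1 p.2)
  invFun p := ((shift d).symm p.1, (Φ.fib ((shift d).symm p.1)).symm p.2)
  left_inv p := by simp
  right_inv p := by simp

/-- The one-step skew-product `τ × (φ_1, …, φ_d)`: `φ_ξ` is the map indexed by `ξ_0`. -/
def oneStep (φ : Fin d → M ≃ₜ M) : SkewProduct d M where
  fib ξ := φ (ξ 0)
  continuous_fib := by
    have h : Continuous fun q : Fin d × M => φ q.1 q.2 :=
      continuous_prod_of_discrete_left.2 fun i => (φ i).continuous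
    have h' : Continuous fun p : Seq d × M => (p.1 0, p.2) := by fun_prop
    exact h.comp h'
  continuous_fib_symm := by
    have h : Continuous fun q : Fin d × M => (φ q.1).symm q.2 :=
      continuous_prod_of_discrete_left.2 fun i => (φ i).symm.continuous
    have h' : Continuous fun p : Seq d × M => (p.1 0, p.2) := by fun_prop
    exact h.comp h'

/-- The associated inverse skew-product `Φ* = τ × φ*_ξ`, `φ*_ξ = (φ_{ξ*})⁻¹`. -/
def inverse (Φ : SkewProduct d M) : SkewProduct d M where
  fib ξ := (Φ.fib (conjSeq ξ)).symm
  continuous_fib := by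
    have h : Continuous fun p : Seq d × M => (conjSeq p.1, p.2) := by
      unfold conjSeq; fun_prop
    exact Φ.continuous_fib_symm.comp h
  continuous_fib_symm := by
    have h : Continuous fun p : Seq d × M => (conjSeq p.1, p.2) := by
      unfold conjSeq; fun_prop
    exact Φ.continuous_fib.comp h

/-- The inclusion `Σ_k ⊂ Σ_{k+l}` (sequences that use only the first `k` symbols). -/
def inclSeq (k l : ℕ) (ξ : Seq k) : Seq (k + l) := fun i => Fin.castAdd l (ξ i)

theorem continuous_inclSeq (k l : ℕ) : Continuous (inclSeq k l) :=
  continuous_pi fun i =>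
    (continuous_of_discreteTopology (f := Fin.castAdd l)).comp (continuous_apply i)

/-- The restriction of a skew-product on `Σ_{k+l} × M` to `Σ_k × M`. -/
def restrict {k l : ℕ} (Φ : SkewProduct (k + l) M) : SkewProduct k M where
  fib ξ := Φ.fib (inclSeq k l ξ)
  continuous_fib := by
    have h : Continuous fun p : Seq k × M => (inclSeq k l p.1, p.2) :=
      ((continuous_inclSeq k l).comp continuous_fst).prodMk continuous_snd
    exact Φ.continuous_fib.comp h
  continuous_fib_symm := by
    have h : Continuous fun p : Seq k × M => (inclSeq k l p.1, p.2) :=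
      ((continuous_inclSeq k l).comp continuous_fst).prodMk continuous_snd
    exact Φ.continuous_fib_symm.comp h

/-- The maximal invariant set `⋂_{n ∈ ℤ} Φ^n(Σ_d × closure D)`. -/
def maxInv (Φ : SkewProduct d M) (D : Set M) : Set (Seq d × M) :=
  ⋂ n : ℤ, (Φ.map ^ n) '' (univ ×ˢ closure D)

/-- The maximal invariant set in `Σ_k × closure D` of the restriction of `Φ` to `Σ_k × M`, as a
subset of the larger space `Σ_{k+l} × M`. -/
def subMaxInv {k l : ℕ} (D : Set M) (Φ : SkewProduct (k + l) M) : Set (Seq (k + l) × M) :=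
  (fun p : Seq k × M => (inclSeq k l p.1, p.2)) '' (Φ.restrict (k := k) (l := l)).maxInv D

/-- The local strong unstable set `W^uu_loc((ξ, x); Φ)`: the graph over `W^u_loc(ξ; τ)` of
`ξ' ↦ lim_n φ^n_{τ^{-n} ξ'} ((φ^n_{τ^{-n} ξ})⁻¹ x)`. -/
def localUU (Φ : SkewProduct d M) (p : Seq d × M) : Set (Seq d × M) :=
  {q | q.1 ∈ unstableSeq p.1 ∧
    Tendsto (fun n : ℕ =>
      ((Φ.map ^ (n : ℤ)) (((shift d) ^ (-(n : ℤ))) q.1, ((Φ.map ^ (-(n : ℤ))) p).2)).2)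
      atTop (𝓝 q.2)}

/-- `W^uu_loc(Γ; Φ)`, the union of the local strong unstable sets of the points of `Γ`. -/
def localUUSet (Φ : SkewProduct d M) (Γ : Set (Seq d × M)) : Set (Seq d × M) :=
  ⋃ p ∈ Γ, Φ.localUU p

end Topological

section Metric

variable {d : ℕ} {M : Type*} [MetricSpace M]

/-- The distance in `Σ_d × M` from a point to a set (`∞` if the set is empty). -/
noncomputable def distToSet (ν : ℝ) (p : Seq d × M) (Γ : Set (Seq d × M)) : ℝ≥0∞ :=
  ⨅ q ∈ Γ, ENNReal.ofReal (seqDist ν p.1 q.1) + edist p.2 q.2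

/-- The global stable set `W^s(Γ; Φ)`. -/
def stableSet (ν : ℝ) (Φ : SkewProduct d M) (Γ : Set (Seq d × M)) : Set (Seq d × M) :=
  {p | Tendsto (fun n : ℕ => distToSet ν ((Φ.map ^ (n : ℤ)) p) Γ) atTop (𝓝 0)}

/-- The global unstable set `W^u(Γ; Φ)`. -/
def unstableSet (ν : ℝ) (Φ : SkewProduct d M) (Γ : Set (Seq d × M)) : Set (Seq d × M) :=
  {p | Tendsto (fun n : ℕ => distToSet ν ((Φ.map ^ (-(n : ℤ))) p) Γ) atTop (𝓝 0)}

/-- `Φ` has a symbolic cycle associated with the `Φ`-invariant sets `Γ₁` and `Γ₂`. -/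
def HasSymbolicCycle (ν : ℝ) (Φ : SkewProduct d M) (Γ₁ Γ₂ : Set (Seq d × M)) : Prop :=
  Φ.map '' Γ₁ = Γ₁ ∧ Φ.map '' Γ₂ = Γ₂ ∧
  (Φ.stableSet ν Γ₁ ∩ Φ.unstableSet ν Γ₂).Nonempty ∧
  (Φ.unstableSet ν Γ₁ ∩ Φ.stableSet ν Γ₂).Nonempty

/-- `C` is a local `α`-Hölder bound for the fibre maps and their inverses on `closure D`. -/
def IsHolderBound (ν α : ℝ) (D : Set M) (Φ : SkewProduct d M) (C : ℝ) : Prop :=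
  0 ≤ C ∧ ∀ ξ ζ : Seq d, ξ 0 = ζ 0 → ∀ x ∈ closure D,
    dist (Φ.fib ξ x) (Φ.fib ζ x) ≤ C * seqDist ν ξ ζ ^ α ∧
    dist ((Φ.fib ξ).symm x) ((Φ.fib ζ).symm x) ≤ C * seqDist ν ξ ζ ^ α

/-- The local Hölder constant `C_Φ` on `closure D`: the smallest bound. -/
noncomputable def holderConst (ν α : ℝ) (D : Set M) (Φ : SkewProduct d M) : ℝ :=
  sInf {C : ℝ | IsHolderBound ν α D Φ C}

/-- `f` is `(lam, bet)`-Lipschitz on `s`. -/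
def IsBiLipschitzOn (lam bet : ℝ) (f : M → M) (s : Set M) : Prop :=
  ∀ x ∈ s, ∀ y ∈ s, x ≠ y →
    lam * dist x y < dist (f x) (f y) ∧ dist (f x) (f y) < bet * dist x y

/-- The `C^0` distance between `f` and `g` on `closure D`. -/
noncomputable def c0Dist (D : Set M) (f g : M → M) : ℝ≥0∞ :=
  ⨆ x ∈ closure D, edist (f x) (g x)

/-- The distance `sup_ξ d_{C^0}(φ_ξ, ψ_ξ) + |C_Φ - C_Ψ|` on `S^{0,α}(D)`. -/
noncomputable def s0Dist (ν α : ℝ) (D : Set M) (Φ Ψ : SkewProduct d M) : ℝ≥0∞ :=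
  (⨆ ξ : Seq d, c0Dist D (Φ.fib ξ) (Ψ.fib ξ)) +
    ENNReal.ofReal |holderConst ν α D Φ - holderConst ν α D Ψ|

/-- `H` is an almost `δ`-horizontal disk in `Σ_d × B`. -/
def IsHorizontalDisk (ν α δ : ℝ) (B : Set M) (H : Set (Seq d × M)) : Prop :=
  ∃ (ζ : Seq d) (z : M) (C : ℝ) (h : Seq d → M), z ∈ B ∧ 0 ≤ C ∧
    (∀ ξ ∈ stableSeq ζ, h ξ ∈ B ∧ dist z (h ξ) < δ) ∧
    (∀ ξ ∈ stableSeq ζ, ∀ ξ' ∈ stableSeq ζ, dist (h ξ) (h ξ') ≤ C * seqDist ν ξ ξ' ^ α) ∧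
    C * ν ^ α < δ ∧
    H = (fun ξ => (ξ, h ξ)) '' stableSeq ζ

end Metric

section Manifold

variable {n d : ℕ} {M : Type*} [MetricSpace M] [ChartedSpace (EuclideanSpace ℝ (Fin n)) M]

variable (n) in
/-- Membership in the set `S^{r,α}_{d,lam,bet}(D)` of symbolic skew-products, including the
standing convention on the domain `D` in the contracting and expanding cases. -/
structure MemS (r : ℕ∞) (ν α lam bet : ℝ) (D : Set M) (Φ : SkewProduct d M) : Prop where
  two_le : 2 ≤ d
  alpha_nonneg : 0 ≤ α
  alpha_le_one : α ≤ 1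
  lam_pos : 0 < lam
  lam_lt_bet : lam < bet
  isOpen : IsOpen D
  isBounded : Bornology.IsBounded D
  contMDiff : ∀ ξ, ContMDiff (𝓡 n) (𝓡 n) r (Φ.fib ξ)
  contMDiff_symm : ∀ ξ, ContMDiff (𝓡 n) (𝓡 n) r (Φ.fib ξ).symm
  lipschitz : ∀ ξ, IsBiLipschitzOn lam bet (Φ.fib ξ) (closure D)
  holder : ∃ C, IsHolderBound ν α D Φ C
  contracting : bet < 1 → ∀ ξ, Φ.fib ξ '' closure D ⊆ D
  expanding : 1 < lam → ∀ ξ, closure D ⊆ Φ.fib ξ '' D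

variable (n) in
/-- Membership in the set `PHS^{r,α}_{d,lam,bet}(M)` of partially hyperbolic skew-products. -/
def MemPHS (r : ℕ∞) (ν α lam bet : ℝ) (Φ : SkewProduct d M) : Prop :=
  MemS n r ν α lam bet univ Φ ∧ ν ^ α < lam ∧ lam < 1 ∧ 1 < bet ∧ bet < ν ^ (-α)

variable (n) in
/-- The maximal invariant set of `Φ` in `Σ_d × closure D` is a symbolic cs-blender-horseshoe with
superposition domain `B` (as an element of `S^{0,α}_{d,lam,bet}(D)`). Every nonempty open subset
of a superposition domain is again one, so a superposition domain contains `B` iff `B` is one. -/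
def IsCsBlender (ν α lam bet : ℝ) (D : Set M) (Φ : SkewProduct d M) (B : Set M) : Prop :=
  MemS n 0 ν α lam bet D Φ ∧ bet < 1 ∧ 0 < α ∧ IsOpen B ∧ B.Nonempty ∧ B ⊆ D ∧
  ∃ δ > (0 : ℝ), ∃ ε > (0 : ℝ≥0∞), ∀ Ψ : SkewProduct d M,
    MemS n 0 ν α lam bet D Ψ → s0Dist ν α D Φ Ψ < ε →
    ∀ H, IsHorizontalDisk ν α δ B H → (Ψ.localUUSet (Ψ.maxInv D) ∩ H).Nonempty

variable (n) in
/-- Symbolic cu-blender-horseshoe for `Φ ∈ S^{0,α}_{d,lam,bet}(D)`, `lam > 1`: a symbolic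
cs-blender-horseshoe for the associated inverse skew-product
`Φ* ∈ S^{0,α}_{d,bet⁻¹,lam⁻¹}(D)`. -/
def IsCuBlender (ν α lam bet : ℝ) (D : Set M) (Φ : SkewProduct d M) (B : Set M) : Prop :=
  MemS n 0 ν α lam bet D Φ ∧ 1 < lam ∧ IsCsBlender n ν α bet⁻¹ lam⁻¹ D Φ.inverse B

variable (n) in
/-- `e` is a smooth injective immersion into `ℝ^N` (for compact `M`: a smooth embedding). -/
def IsSmoothEmb {N : ℕ} (e : M → EuclideanSpace ℝ (Fin N)) : Prop :=
  ContMDiff (𝓡 n) (𝓡 N) ∞ e ∧ Function.Injective e ∧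
    ∀ x, Function.Injective (mfderiv (𝓡 n) (𝓡 N) e x)

variable (n) in
/-- The derivative of `e ∘ f` at `x` applied to the tangent vector `v`, as a vector of `ℝ^N`. -/
noncomputable def embDeriv {N : ℕ} (e : M → EuclideanSpace ℝ (Fin N)) (f : M → M) (x : M)
    (v : TangentSpace (𝓡 n) x) : EuclideanSpace ℝ (Fin N) :=
  mfderiv (𝓡 n) (𝓡 N) (e ∘ f) x v

variable [RiemannianBundle (fun x : M => TangentSpace (𝓡 n) x)]

variable (n) in
/-- The `C^1` distance on `M`, where derivatives at different points are compared through `e`. -/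
noncomputable def c1Dist {N : ℕ} (e : M → EuclideanSpace ℝ (Fin N)) (f g : M → M) : ℝ≥0∞ :=
  c0Dist univ f g +
    ⨆ (x : M) (v : TangentSpace (𝓡 n) x) (_ : ‖v‖ ≤ 1),
      edist (embDeriv n e f x v) (embDeriv n e g x v)

variable (n) in
/-- The distance `sup_ξ d_{C^1}(φ_ξ, ψ_ξ) + |C_Φ - C_Ψ|` on `S^{1,α}(M)`. -/
noncomputable def s1Dist {N : ℕ} (e : M → EuclideanSpace ℝ (Fin N)) (ν α : ℝ)
    (Φ Ψ : SkewProduct d M) : ℝ≥0∞ :=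
  (⨆ ξ : Seq d, c1Dist n e (Φ.fib ξ) (Ψ.fib ξ)) +
    ENNReal.ofReal |holderConst ν α univ Φ - holderConst ν α univ Ψ|

variable (n) in
/-- `P` holds for every small enough `S^{1,α}`-perturbation of `Φ`, where a perturbation is a
skew-product in `S^{1,α}_{d,lam,bet}(M)` for some `lam, bet`. On a compact manifold the topology
given by `s1Dist` does not depend on the embedding `e`; we ask for a neighbourhood for each `e`. -/
def ForSmallPerturbations (ν α : ℝ) (Φ : SkewProduct d M) (P : SkewProduct d M → Prop) : Prop :=
  ∀ (N : ℕ) (e : M → EuclideanSpace ℝ (Fin N)), IsSmoothEmb n e →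
    ∃ ε > (0 : ℝ≥0∞), ∀ Ψ : SkewProduct d M,
      (∃ lam bet, MemS n 1 ν α lam bet univ Ψ) → s1Dist n e ν α Φ Ψ < ε → P Ψ

variable (n) in
/-- `S^{1,α}`-robust symbolic cycle of `Φ` associated with two invariant sets, whose continuations
for a perturbation `Ψ` are `Γ₁ Ψ` and `Γ₂ Ψ`. -/
def HasRobustSymbolicCycle (ν α : ℝ) (Φ : SkewProduct d M)
    (Γ₁ Γ₂ : SkewProduct d M → Set (Seq d × M)) : Prop :=
  HasSymbolicCycle ν Φ (Γ₁ Φ) (Γ₂ Φ) ∧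
    ForSmallPerturbations n ν α Φ fun Ψ => HasSymbolicCycle ν Ψ (Γ₁ Ψ) (Γ₂ Ψ)

end Manifold

end SkewProduct

end SymbolicSkew

/-! Everything rests on a graph transform. A horizontal disk `h` over a local stable set is pulled
back to `ξ ↦ (fib ξ)⁻¹ (h (τ ξ))`. Sequences with a common future are brought closer by the factor
`ν` under the shift, so if the inverse fibre maps expand by at most `L`, a Hölder constant `C`
becomes at most `L ν^α C + c`, where `c` bounds the Hölder dependence of the fibre maps. Partial
hyperbolicity gives `L ν^α < 1`, and near a one-step map `c` is small, so horizontality survives.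
The covering property supplies a symbol for which the pulled-back disk lies in `B` again. Repeating
this forever chooses a past for the base sequence, and hence a point of the original disk whose
whole backward orbit lies in `B` (`exists_backward_orbit`). If the fibre maps send `closure D` into
`D`, its forward orbit stays in `D` too, so the point is in the maximal invariant set and on its own
strong unstable leaf: this is the cs-blender. The cu-blender is the same statement for the inverse
skew-product.

One half of the cycle is an open condition: a transition orbit leads from `D_cu` to `D_cs`, which
trap backward and forward orbits respectively. The other half needs both blenders
(`exists_unstableSet_inter_stableSet`). The covering of `B_cu` gives a forward orbit that starts at
the end of the other transition and never leaves `B_cu`. A constant disk at its time-`N` point is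
pulled back along it, and then along the transition, to a horizontal disk near `x ∈ B_cs`; the
covering of `B_cs` finds on it a point whose past stays in `B_cs`. Letting `N → ∞`, compactness
gives the heteroclinic point.

Robustness uses two facts about `M`. Balls are connected, because the distance is an infimum of
lengths, and this makes the covering stable under `C^0` perturbations
(`exists_covering_perturbation`). A `C^1`-small perturbation changes fibre distances only by a
factor close to one (`exists_lipClose_of_s1Dist_lt`), so the Lipschitz constants keep their strict
inequalities. -/

namespace SymbolicSkew

/-! ### The sequence space: symbolic distance and local stable sets. -/

section Sequences

variable {d : ℕ} {ν : ℝ}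

theorem shift_apply (ξ : Seq d) (i : ℤ) : shift d ξ i = ξ (i + 1) := rfl

theorem shift_symm_apply (ξ : Seq d) (i : ℤ) : (shift d).symm ξ i = ξ (i - 1) := rfl

theorem shift_zpow_apply (n : ℤ) (ξ : Seq d) (i : ℤ) : ((shift d) ^ n) ξ i = ξ (i + n) := by
  induction n generalizing ξ with
  | zero => simp
  | succ n ih =>
    rw [zpow_add_one, Equiv.Perm.mul_apply, ih, shift_apply]; congr 1; ring
  | pred n ih =>
    rw [zpow_sub_one, Equiv.Perm.mul_apply, ih, Equiv.Perm.inv_def, shift_symm_apply]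
    congr 1; ring

theorem exists_seqDist_eq {ξ ζ : Seq d} (h : ξ ≠ ζ) : ∃ l : ℕ, seqDist ν ξ ζ = ν ^ l ∧
    (∀ i : ℤ, |i| < l → ξ i = ζ i) ∧ (ξ l ≠ ζ l ∨ ξ (-l) ≠ ζ (-l)) := by
  classical
  set S := {i : ℕ | ξ (i : ℤ) ≠ ζ (i : ℤ) ∨ ξ (-(i : ℤ)) ≠ ζ (-(i : ℤ))} with hS
  have hne : S.Nonempty := by
    obtain ⟨i, hi⟩ := Function.ne_iff.1 h
    refine ⟨i.natAbs, ?_⟩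
    rcases Int.natAbs_eq i with h' | h'
    · left; rwa [← h']
    · right; rwa [← h']
  refine ⟨sInf S, by simp [seqDist, h, hS], fun i hi => ?_, Nat.sInf_mem hne⟩
  by_contra hcon
  have : i.natAbs ∈ S := by
    rcases Int.natAbs_eq i with h' | h'
    · left; rwa [← h']
    · right; rwa [← h']
  have := Nat.sInf_le this
  rw [Int.abs_eq_natAbs] at hi
  omega

theorem seqDist_self (ξ : Seq d) : seqDist ν ξ ξ = 0 := by simp [seqDist]

theorem seqDist_nonneg (hν : 0 < ν) (ξ ζ : Seq d) : 0 ≤ seqDist ν ξ ζ := by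
  unfold seqDist; split_ifs <;> positivity

theorem seqDist_le_pow (hν : 0 < ν) (hν1 : ν < 1) {ξ ζ : Seq d} {n : ℕ}
    (h : ∀ i : ℤ, |i| < n → ξ i = ζ i) : seqDist ν ξ ζ ≤ ν ^ n := by
  by_cases hne : ξ = ζ
  · rw [hne, seqDist_self]; positivity
  obtain ⟨l, hl, -, h2⟩ := exists_seqDist_eq (ν := ν) hne
  rw [hl]
  apply pow_le_pow_of_le_one hν.le hν1.le
  by_contra hlt
  push Not at hlt
  rcases h2 with h2 | h2
  · exact h2 (h _ (by rw [abs_of_nonneg (by positivity)]; exact_mod_cast hlt))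
  · exact h2 (h _ (by rw [abs_neg, abs_of_nonneg (by positivity)]; exact_mod_cast hlt))

theorem seqDist_congr {d' : ℕ} {ξ ζ : Seq d} {ξ' ζ' : Seq d'}
    (h : ∀ i : ℕ, (ξ i ≠ ζ i ∨ ξ (-i) ≠ ζ (-i)) ↔ (ξ' i ≠ ζ' i ∨ ξ' (-i) ≠ ζ' (-i))) :
    seqDist ν ξ ζ = seqDist ν ξ' ζ' := by
  have key : ∀ {e : ℕ} (a b : Seq e), a = b ↔ ∀ i : ℕ, ¬ (a i ≠ b i ∨ a (-i) ≠ b (-i)) := by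
    intro e a b
    constructor
    · rintro rfl; simp
    · intro H
      by_contra hab
      obtain ⟨l, -, -, hl⟩ := exists_seqDist_eq (ν := 1) hab
      exact H l hl
  have h1 : ξ = ζ ↔ ξ' = ζ' := by
    rw [key, key]; simp only [h]
  unfold seqDist
  simp only [h]
  by_cases hh : ξ = ζ
  · rw [if_pos hh, if_pos (h1.1 hh)]
  · rw [if_neg hh, if_neg (mt h1.2 hh)]

theorem seqDist_conjSeq (ξ ζ : Seq d) : seqDist ν (conjSeq ξ) (conjSeq ζ) = seqDist ν ξ ζ :=
  seqDist_congr fun i => by simp only [conjSeq, neg_neg]; exact or_comm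

theorem seqDist_inclSeq {k l : ℕ} (ξ ζ : Seq k) :
    seqDist ν (SkewProduct.inclSeq k l ξ) (SkewProduct.inclSeq k l ζ) = seqDist ν ξ ζ :=
  seqDist_congr fun i => by simp [SkewProduct.inclSeq]

theorem seqDist_le_one (hν : 0 < ν) (hν1 : ν < 1) (ξ ζ : Seq d) : seqDist ν ξ ζ ≤ 1 := by
  simpa using seqDist_le_pow hν hν1 (ξ := ξ) (ζ := ζ) (n := 0)
    fun i hi => absurd hi (by simp)

/-- A common future forces the first disagreement to sit at some `-l`, which the shift moves to `-l
- 1`. This is the source of every factor `ν ^ α`. -/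
theorem seqDist_shift_le (hν : 0 < ν) (hν1 : ν < 1) {ξ ζ : Seq d}
    (h : ∀ i : ℤ, 0 ≤ i → ξ i = ζ i) :
    seqDist ν (shift d ξ) (shift d ζ) ≤ ν * seqDist ν ξ ζ := by
  by_cases hne : ξ = ζ
  · simp [hne, seqDist_self]
  obtain ⟨l, hl, h1, -⟩ := exists_seqDist_eq (ν := ν) hne
  rw [hl, ← pow_succ']
  refine seqDist_le_pow hν hν1 fun i hi => ?_
  rw [shift_apply, shift_apply]
  by_cases h0 : 0 ≤ i + 1
  · exact h _ h0
  · refine h1 _ ?_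
    rw [abs_lt] at hi ⊢
    push_cast at hi
    omega

theorem mem_stableSeq_self (ξ : Seq d) : ξ ∈ stableSeq ξ := fun _ _ => rfl

theorem stableSeq_trans {ξ ζ η : Seq d} (h : ξ ∈ stableSeq ζ) (h' : ζ ∈ stableSeq η) :
    ξ ∈ stableSeq η := fun i hi => (h i hi).trans (h' i hi)

theorem shift_mem_stableSeq {ξ ζ : Seq d} (h : ξ ∈ stableSeq ζ) :
    shift d ξ ∈ stableSeq (shift d ζ) := fun i hi => h (i + 1) (by omega)

/-- The sequence with `τ⁻¹ζ` except that the symbol at the origin is `a`. -/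
def prepend (a : Fin d) (ζ : Seq d) : Seq d := fun i => if i = 0 then a else ζ (i - 1)

theorem prepend_zero (a : Fin d) (ζ : Seq d) : prepend a ζ 0 = a := by simp [prepend]

theorem prepend_add_one (a : Fin d) (ζ : Seq d) {i : ℤ} (hi : 0 ≤ i) :
    prepend a ζ (i + 1) = ζ i := by
  have : i + 1 ≠ 0 := by omega
  simp [prepend, this]

theorem shift_prepend (a : Fin d) (ζ : Seq d) : shift d (prepend a ζ) ∈ stableSeq ζ :=
  fun _ hi => prepend_add_one a ζ hi

end Sequences

namespace SkewProduct

/-! ### Iterates and maximal invariant sets. -/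

section Iterates

variable {d : ℕ} {M : Type*} [TopologicalSpace M]

theorem map_apply (Φ : SkewProduct d M) (p : Seq d × M) :
    Φ.map p = (shift d p.1, Φ.fib p.1 p.2) := rfl

theorem map_symm_apply (Φ : SkewProduct d M) (p : Seq d × M) :
    Φ.map⁻¹ p = ((shift d).symm p.1, (Φ.fib ((shift d).symm p.1)).symm p.2) := rfl

theorem map_zpow_fst (Φ : SkewProduct d M) (n : ℤ) (p : Seq d × M) :
    ((Φ.map ^ n) p).1 = ((shift d) ^ n) p.1 := by
  induction n generalizing p with
  | zero => simp
  | succ n ih => rw [zpow_add_one, Equiv.Perm.mul_apply, ih, zpow_add_one]; rfl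
  | pred n ih => rw [zpow_sub_one, Equiv.Perm.mul_apply, ih, zpow_sub_one]; rfl

theorem map_zpow_fst_apply (Φ : SkewProduct d M) (n i : ℤ) (p : Seq d × M) :
    ((Φ.map ^ n) p).1 i = p.1 (i + n) := by
  rw [map_zpow_fst, shift_zpow_apply]

theorem map_zpow_add_one (Φ : SkewProduct d M) (n : ℤ) (p : Seq d × M) :
    (Φ.map ^ (n + 1)) p = Φ.map ((Φ.map ^ n) p) := by
  rw [add_comm, zpow_add, zpow_one, Equiv.Perm.mul_apply]

theorem map_zpow_sub_one (Φ : SkewProduct d M) (n : ℤ) (p : Seq d × M) :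
    (Φ.map ^ (n - 1)) p = Φ.map⁻¹ ((Φ.map ^ n) p) := by
  rw [sub_eq_neg_add, zpow_add, zpow_neg_one, Equiv.Perm.mul_apply]

theorem map_zpow_add (Φ : SkewProduct d M) (m n : ℤ) (p : Seq d × M) :
    (Φ.map ^ (m + n)) p = (Φ.map ^ m) ((Φ.map ^ n) p) := by
  rw [zpow_add, Equiv.Perm.mul_apply]

theorem mem_maxInv {Φ : SkewProduct d M} {D : Set M} {p : Seq d × M} :
    p ∈ Φ.maxInv D ↔ ∀ n : ℤ, ((Φ.map ^ n) p).2 ∈ closure D := by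
  simp only [maxInv, mem_iInter, mem_image, mem_prod, mem_univ, true_and]
  constructor
  · intro h n
    obtain ⟨q, hq, hqp⟩ := h (-n)
    rw [← hqp, ← map_zpow_add]
    simpa using hq
  · intro h n
    exact ⟨(Φ.map ^ (-n)) p, h (-n), by rw [← map_zpow_add]; simp⟩

theorem map_image_maxInv (Φ : SkewProduct d M) (D : Set M) : Φ.map '' Φ.maxInv D = Φ.maxInv D := by
  ext p
  constructor
  · rintro ⟨q, hq, rfl⟩
    rw [mem_maxInv] at hq ⊢
    intro n
    have := hq (n + 1)
    rwa [map_zpow_add, zpow_one] at this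
  · intro hp
    refine ⟨Φ.map⁻¹ p, ?_, by simp⟩
    rw [mem_maxInv] at hp ⊢
    intro n
    have := hp (n - 1)
    rwa [sub_eq_add_neg, map_zpow_add, zpow_neg_one] at this

theorem mem_localUU_self (Φ : SkewProduct d M) (p : Seq d × M) : p ∈ Φ.localUU p := by
  refine ⟨fun _ _ => rfl, ?_⟩
  have : ∀ n : ℕ, ((Φ.map ^ (n : ℤ)) (((shift d) ^ (-(n : ℤ))) p.1,
      ((Φ.map ^ (-(n : ℤ))) p).2)).2 = p.2 := by
    intro n
    rw [← map_zpow_fst Φ, Prod.mk.eta, ← map_zpow_add]; simp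
  simp only [this]
  exact tendsto_const_nhds

end Iterates

/-! ### The graph transform on horizontal disks. -/

section GraphTransform

variable {d : ℕ} {M : Type*} [MetricSpace M] {ν α : ℝ}

/-- `h` is `α`-Hölder with constant `C` on the local stable set of `ζ`. -/
def HolderOnStable (ν α C : ℝ) (ζ : Seq d) (h : Seq d → M) : Prop :=
  ∀ ξ ∈ stableSeq ζ, ∀ ξ' ∈ stableSeq ζ, dist (h ξ) (h ξ') ≤ C * seqDist ν ξ ξ' ^ α

/-- The graph transform of `h` under the inverse of `Ψ`. -/
def pullback (Ψ : SkewProduct d M) (h : Seq d → M) : Seq d → M :=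
  fun ξ => (Ψ.fib ξ).symm (h (shift d ξ))

theorem map_pullback (Ψ : SkewProduct d M) (h : Seq d → M) (ξ : Seq d) :
    Ψ.map (ξ, Ψ.pullback h ξ) = (shift d ξ, h (shift d ξ)) := by
  simp [map_apply, pullback]

/-- The intermediate point `(Ψ.fib ξ).symm (h (shift d η))` splits the difference: moving the point
costs `L` and gains `ν ^ α` from the shift, changing the fibre map costs `c`. Both estimates are
required only at values of `h`, so they may be local. -/
theorem HolderOnStable.pullback (hν : 0 < ν) (hν1 : ν < 1) (hα : 0 ≤ α) {Ψ : SkewProduct d M}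
    {C L c : ℝ} (hC : 0 ≤ C) (hL : 0 ≤ L) {ζ ζ' : Seq d} {h : Seq d → M}
    (hh : HolderOnStable ν α C ζ h) (hζ : shift d ζ' ∈ stableSeq ζ)
    (hlip : ∀ ξ ∈ stableSeq ζ', ∀ η ∈ stableSeq ζ',
      dist ((Ψ.fib ξ).symm (h (shift d ξ))) ((Ψ.fib ξ).symm (h (shift d η))) ≤
        L * dist (h (shift d ξ)) (h (shift d η)))
    (hhol : ∀ ξ ∈ stableSeq ζ', ∀ η ∈ stableSeq ζ',
      dist ((Ψ.fib ξ).symm (h (shift d η))) ((Ψ.fib η).symm (h (shift d η))) ≤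
        c * seqDist ν ξ η ^ α) :
    HolderOnStable ν α (L * ν ^ α * C + c) ζ' (Ψ.pullback h) := by
  intro ξ hξ η hη
  have hs : ∀ {ξ}, ξ ∈ stableSeq ζ' → shift d ξ ∈ stableSeq ζ := fun h =>
    stableSeq_trans (shift_mem_stableSeq h) hζ
  have h1 := hlip ξ hξ η hη
  have h2 := hhol ξ hξ η hη
  have h3 := hh _ (hs hξ) _ (hs hη)
  have h4 : seqDist ν (shift d ξ) (shift d η) ^ α ≤ ν ^ α * seqDist ν ξ η ^ α := by
    rw [← Real.mul_rpow hν.le (seqDist_nonneg hν _ _)]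
    refine Real.rpow_le_rpow (seqDist_nonneg hν _ _) (seqDist_shift_le hν hν1 fun i hi => ?_) hα
    rw [hξ i hi, hη i hi]
  calc _ ≤ _ := dist_triangle _ ((Ψ.fib ξ).symm (h (shift d η))) _
    _ ≤ L * (C * (ν ^ α * seqDist ν ξ η ^ α)) + c * seqDist ν ξ η ^ α := by
      refine add_le_add (h1.trans ?_) h2
      gcongr
      exact h3.trans (by gcongr)
    _ = _ := by ring

/-- `h` defines a `δ`-horizontal disk in `B` over the local stable set of `ζ`. -/
def IsHorizontalGraph (ν α δ : ℝ) (B : Set M) (ζ : Seq d) (h : Seq d → M) : Prop :=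
  (∃ z ∈ B, ∀ ξ ∈ stableSeq ζ, h ξ ∈ B ∧ dist z (h ξ) < δ) ∧
    ∃ C, 0 ≤ C ∧ HolderOnStable ν α C ζ h ∧ C * ν ^ α < δ

/-- By `hδ` the bound `C * ν ^ α < δ` passes to the new Hölder constant. It also controls the
diameter: sequences in one local stable set agree at the origin, so their distance is at most `ν`.
The new disk can therefore be centred at its own value over `prepend (ι i) ζ`. -/
theorem IsHorizontalGraph.exists_pullback (hν : 0 < ν) (hν1 : ν < 1) (hα : 0 ≤ α) {k : ℕ}
    {Ψ : SkewProduct d M} {ι : Fin k → Fin d} {δ L c : ℝ} (hL : 0 < L) (hc : 0 ≤ c) {B : Set M}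
    (hcov : ∀ z ∈ B, ∃ i, ∀ ξ : Seq d, ξ 0 = ι i → ∀ w, dist z w < δ → (Ψ.fib ξ).symm w ∈ B)
    (hlip : ∀ ξ : Seq d, ξ 0 ∈ range ι → ∀ a b, (Ψ.fib ξ).symm a ∈ B → (Ψ.fib ξ).symm b ∈ B →
      dist ((Ψ.fib ξ).symm a) ((Ψ.fib ξ).symm b) ≤ L * dist a b)
    (hhol : ∀ ξ ζ : Seq d, ξ 0 = ζ 0 → ∀ x ∈ B,
      dist ((Ψ.fib ξ).symm x) ((Ψ.fib ζ).symm x) ≤ c * seqDist ν ξ ζ ^ α)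
    (hδ : L * ν ^ α * δ + c * ν ^ α ≤ δ) {ζ : Seq d} {h : Seq d → M}
    (hh : IsHorizontalGraph ν α δ B ζ h) :
    ∃ i, IsHorizontalGraph ν α δ B (prepend (ι i) ζ) (Ψ.pullback h) := by
  obtain ⟨⟨z, hz, hzh⟩, C, hC, hhC, hCδ⟩ := hh
  obtain ⟨i, hi⟩ := hcov z hz
  refine ⟨i, ?_⟩
  set ζ' := prepend (ι i) ζ with hζ'
  have hs : ∀ {ξ}, ξ ∈ stableSeq ζ' → shift d ξ ∈ stableSeq ζ := fun h =>
    stableSeq_trans (shift_mem_stableSeq h) (shift_prepend _ _)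
  have h0 : ∀ {ξ}, ξ ∈ stableSeq ζ' → ξ 0 = ι i := fun h =>
    (h 0 le_rfl).trans (prepend_zero _ _)
  have hB : ∀ {ξ η}, ξ ∈ stableSeq ζ' → η ∈ stableSeq ζ' →
      (Ψ.fib ξ).symm (h (shift d η)) ∈ B := fun hξ hη => hi _ (h0 hξ) _ (hzh _ (hs hη)).2
  have hνα : 0 < ν ^ α := Real.rpow_pos_of_pos hν α
  have hC' : (L * ν ^ α * C + c) * ν ^ α < δ := by
    have : L * ν ^ α * (C * ν ^ α) < L * ν ^ α * δ := by gcongr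
    nlinarith
  have hH : HolderOnStable ν α (L * ν ^ α * C + c) ζ' (Ψ.pullback h) :=
    hhC.pullback hν hν1 hα hC hL.le (shift_prepend _ _)
      (fun ξ hξ η hη => hlip ξ ⟨i, (h0 hξ).symm⟩ _ _ (hB hξ hξ) (hB hξ hη))
      (fun ξ hξ η hη => hhol ξ η ((h0 hξ).trans (h0 hη).symm) _ (hzh _ (hs hη)).1)
  refine ⟨⟨Ψ.pullback h ζ', hB (mem_stableSeq_self _) (mem_stableSeq_self _),
    fun ξ hξ => ⟨hB hξ hξ, ?_⟩⟩, _, by positivity, hH, hC'⟩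
  refine (hH _ (mem_stableSeq_self _) _ hξ).trans_lt (lt_of_le_of_lt ?_ hC')
  gcongr
  · exact seqDist_nonneg hν _ _
  · have := seqDist_le_pow hν hν1 (ξ := ζ') (ζ := ξ) (n := 1) fun j hj => by
      have : j = 0 := by rw [abs_lt] at hj; push_cast at hj; omega
      rw [this, h0 hξ, h0 (mem_stableSeq_self _)]
    simpa using this

/-- Each pullback fixes one more symbol of the past, and together these symbols determine `ξ`. The
`n`-th backward image of `(ξ, h ξ)` lies on the `n`-th disk, hence in `B`. -/
theorem exists_backward_orbit (hν : 0 < ν) (hν1 : ν < 1) (hα : 0 ≤ α) {k : ℕ}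
    {Ψ : SkewProduct d M} {ι : Fin k → Fin d} {δ L c : ℝ} (hL : 0 < L) (hc : 0 ≤ c) {B : Set M}
    (hcov : ∀ z ∈ B, ∃ i, ∀ ξ : Seq d, ξ 0 = ι i → ∀ w, dist z w < δ → (Ψ.fib ξ).symm w ∈ B)
    (hlip : ∀ ξ : Seq d, ξ 0 ∈ range ι → ∀ a b, (Ψ.fib ξ).symm a ∈ B → (Ψ.fib ξ).symm b ∈ B →
      dist ((Ψ.fib ξ).symm a) ((Ψ.fib ξ).symm b) ≤ L * dist a b)
    (hhol : ∀ ξ ζ : Seq d, ξ 0 = ζ 0 → ∀ x ∈ B,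
      dist ((Ψ.fib ξ).symm x) ((Ψ.fib ζ).symm x) ≤ c * seqDist ν ξ ζ ^ α)
    (hδ : L * ν ^ α * δ + c * ν ^ α ≤ δ) {ζ : Seq d} {h : Seq d → M}
    (hh : IsHorizontalGraph ν α δ B ζ h) :
    ∃ ξ ∈ stableSeq ζ, (∀ n : ℕ, ξ (-(n : ℤ) - 1) ∈ range ι) ∧
      ∀ n : ℕ, ((Ψ.map ^ (-(n : ℤ))) (ξ, h ξ)).2 ∈ B := by
  let G := {g : Seq d × (Seq d → M) // IsHorizontalGraph ν α δ B g.1 g.2}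
  choose F hF using fun g : G =>
    g.2.exists_pullback hν hν1 hα hL hc hcov hlip hhol hδ
  let g : ℕ → G := fun n => Nat.rec ⟨(ζ, h), hh⟩
    (fun _ g => ⟨(prepend (ι (F g)) g.1.1, Ψ.pullback g.1.2), hF g⟩) n
  have g0 : (g 0).1 = (ζ, h) := rfl
  have gs : ∀ n, (g (n + 1)).1 = (prepend (ι (F (g n))) (g n).1.1, Ψ.pullback (g n).1.2) :=
    fun n => rfl
  -- The symbol at `-n` is the one prepended at the `n`-th pullback, read at the origin of the
  -- `n`-th base sequence.
  let ξ : Seq d := fun i => if 0 ≤ i then ζ i else (g (-i).toNat).1.1 0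
  have key : ∀ n : ℕ, ∀ i : ℤ, 0 ≤ i → ξ (i - n) = (g n).1.1 i := by
    intro n
    induction n with
    | zero => intro i hi; simp [ξ, hi, g0]
    | succ n ih =>
      intro i hi
      rcases hi.eq_or_lt with rfl | hi
      · have h1 : ¬ (0 ≤ (0 : ℤ) - (n + 1 : ℕ)) := by push_cast; omega
        have h2 : (-((0 : ℤ) - (n + 1 : ℕ))).toNat = n + 1 := by push_cast; omega
        simp only [ξ, h1, if_false, h2]
      · rw [gs]
        have := prepend_add_one (ι (F (g n))) (g n).1.1 (i := i - 1) (by omega)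
        rw [sub_add_cancel] at this
        dsimp only
        rw [this, ← ih (i - 1) (by omega)]
        congr 1; push_cast; ring
  have hst : ∀ n : ℕ, ((shift d) ^ (-(n : ℤ))) ξ ∈ stableSeq (g n).1.1 := by
    intro n i hi
    rw [shift_zpow_apply, ← key n i hi, sub_eq_add_neg]
  have horb : ∀ n : ℕ, (Ψ.map ^ (-(n : ℤ))) (ξ, h ξ) =
      (((shift d) ^ (-(n : ℤ))) ξ, (g n).1.2 (((shift d) ^ (-(n : ℤ))) ξ)) := by
    intro n
    induction n with
    | zero => simp [g0]
    | succ n ih =>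
      have e : -((n + 1 : ℕ) : ℤ) = -(n : ℤ) - 1 := by push_cast; ring
      rw [e, map_zpow_sub_one, ih, Equiv.Perm.inv_eq_iff_eq, gs, map_pullback]
      have : shift d (((shift d) ^ (-(n : ℤ) - 1)) ξ) = ((shift d) ^ (-(n : ℤ))) ξ := by
        funext j; rw [shift_apply, shift_zpow_apply, shift_zpow_apply]; congr 1; ring
      rw [this]
  refine ⟨ξ, fun i hi => by simp [ξ, hi], fun n => ?_, fun n => ?_⟩
  · have := key (n + 1) 0 le_rfl
    rw [gs] at this
    dsimp only at this
    rw [prepend_zero] at this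
    refine ⟨F (g n), ?_⟩
    rw [← this]; congr 1; push_cast; ring
  · rw [horb]
    obtain ⟨z, -, hz⟩ := (g n).2.1
    exact (hz _ (hst n)).1

end GraphTransform

/-! ### Stability of the covering property. -/

section Covering

variable {M : Type*} [MetricSpace M] [CompactSpace M]

/-- A Lebesgue number `ρ` puts the `ρ`-ball at `z` inside one `f i '' B`. For `ψ` close to `f i`,
the smaller ball meets the open set `ψ '' B` but not its frontier: a frontier point in it would be
`ψ b` with `b ∈ closure B`, and `f i b ∈ f i '' B` forces `b ∈ B`. Connectedness of the ball then
gives inclusion. -/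
theorem exists_covering_perturbation (hball : ∀ (z : M) (r : ℝ), IsPreconnected (Metric.ball z r))
    {k : ℕ} (f : Fin k → M ≃ₜ M) {B : Set M} (hB : IsOpen B)
    (hcov : closure B ⊆ ⋃ i, f i '' B) :
    ∃ δ > 0, ∀ z ∈ closure B, ∃ i, ∀ ψ : M ≃ₜ M,
      (∀ x ∈ closure B, dist (f i x) (ψ x) < δ) → ∀ w, dist z w < δ → ψ.symm w ∈ B := by
  obtain ⟨ρ, hρ, H⟩ := lebesgue_number_lemma_of_metric isClosed_closure.isCompact
    (fun i => (f i).isOpenMap _ hB) hcov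
  refine ⟨ρ / 2, half_pos hρ, fun z hz => ?_⟩
  obtain ⟨i, hi⟩ := H z hz
  refine ⟨i, fun ψ hψ w hw => ?_⟩
  have hsub : Metric.ball z (ρ / 2) ⊆ ψ '' B := by
    refine (hball z (ρ / 2)).subset_of_closure_inter_subset (ψ.isOpenMap _ hB) ?_ ?_
    · obtain ⟨b, hb, hbz⟩ := hi (Metric.mem_ball_self hρ)
      refine ⟨ψ b, ?_, mem_image_of_mem _ hb⟩
      have := hψ b (subset_closure hb)
      rwa [hbz, dist_comm] at this
    · rintro _ ⟨hu, hub⟩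
      rw [← ψ.image_closure] at hu
      obtain ⟨b, hb, rfl⟩ := hu
      have h1 := hψ b hb
      have : f i b ∈ Metric.ball z ρ := by
        rw [Metric.mem_ball] at hub ⊢
        linarith [dist_triangle (f i b) (ψ b) z]
      obtain ⟨b', hb', hbb⟩ := hi this
      rw [(f i).injective hbb] at hb'
      exact mem_image_of_mem _ hb'
  obtain ⟨b, hb, rfl⟩ := hsub (by rwa [Metric.mem_ball, dist_comm])
  simpa using hb

end Covering

/-! ### The `C^0` distance and Hölder constants. -/

section Distances

variable {d : ℕ} {M : Type*} [MetricSpace M] {ν α : ℝ} {D : Set M}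

theorem c0Dist_triangle (f g h : M → M) : c0Dist D f h ≤ c0Dist D f g + c0Dist D g h :=
  iSup₂_le fun x hx => (edist_triangle _ (g x) _).trans
    (add_le_add (le_iSup₂ (f := fun x _ => edist (f x) (g x)) x hx)
      (le_iSup₂ (f := fun x _ => edist (g x) (h x)) x hx))

theorem s0Dist_triangle (Φ Ψ Θ : SkewProduct d M) :
    s0Dist ν α D Φ Θ ≤ s0Dist ν α D Φ Ψ + s0Dist ν α D Ψ Θ := by
  unfold s0Dist
  rw [add_add_add_comm]
  refine add_le_add (iSup_le fun ξ => (c0Dist_triangle _ (Ψ.fib ξ) _).trans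
    (add_le_add (le_iSup (fun ξ => c0Dist D (Φ.fib ξ) (Ψ.fib ξ)) ξ)
      (le_iSup (fun ξ => c0Dist D (Ψ.fib ξ) (Θ.fib ξ)) ξ))) ?_
  rw [← ENNReal.ofReal_add (abs_nonneg _) (abs_nonneg _)]
  exact ENNReal.ofReal_le_ofReal (abs_sub_le _ _ _)

theorem dist_fib_lt_of_s0Dist_lt {Φ Ψ : SkewProduct d M} {ε : ℝ} 
    (h : s0Dist ν α D Φ Ψ < ENNReal.ofReal ε) (ξ : Seq d) {x : M} (hx : x ∈ closure D) :
    dist (Φ.fib ξ x) (Ψ.fib ξ x) < ε := by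
  have h1 : edist (Φ.fib ξ x) (Ψ.fib ξ x) ≤ s0Dist ν α D Φ Ψ :=
    (le_iSup₂ (f := fun x _ => edist (Φ.fib ξ x) (Ψ.fib ξ x)) x hx).trans
      ((le_iSup (fun ξ => c0Dist D (Φ.fib ξ) (Ψ.fib ξ)) ξ).trans le_self_add)
  have h2 := h1.trans_lt h
  rw [edist_dist] at h2
  exact (ENNReal.ofReal_lt_ofReal_iff_of_nonneg dist_nonneg).1 h2

theorem holderConst_nonneg (Φ : SkewProduct d M) : 0 ≤ holderConst ν α D Φ :=
  Real.sInf_nonneg fun _ h => h.1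

theorem holderConst_le {Φ : SkewProduct d M} {C : ℝ} (h : IsHolderBound ν α D Φ C) :
    holderConst ν α D Φ ≤ C := csInf_le ⟨0, fun _ h => h.1⟩ h

theorem isHolderBound_oneStep (hν : 0 < ν) (φ : Fin d → M ≃ₜ M) {C : ℝ} (hC : 0 ≤ C) :
    IsHolderBound ν α D (oneStep φ) C := by
  refine ⟨hC, fun ξ ζ h x _ => ?_⟩
  have := Real.rpow_nonneg (seqDist_nonneg hν ξ ζ) α
  simp only [oneStep, h, dist_self, and_self]
  positivity

theorem holderConst_oneStep (hν : 0 < ν) (φ : Fin d → M ≃ₜ M) :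
    holderConst ν α D (oneStep φ) = 0 :=
  le_antisymm (holderConst_le (isHolderBound_oneStep hν φ le_rfl)) (holderConst_nonneg _)

theorem exists_isHolderBound_lt (hν : 0 < ν) {φ : Fin d → M ≃ₜ M} {Ψ : SkewProduct d M} {ε : ℝ}
    (hε : 0 < ε) (h : s0Dist ν α D (oneStep φ) Ψ < ENNReal.ofReal ε)
    (hΨ : ∃ C, IsHolderBound ν α D Ψ C) : ∃ C < ε, IsHolderBound ν α D Ψ C := by
  have h1 : ENNReal.ofReal |holderConst ν α D (oneStep φ) - holderConst ν α D Ψ| <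
    ENNReal.ofReal ε := lt_of_le_of_lt le_add_self h
  rw [holderConst_oneStep hν, zero_sub, abs_neg, abs_of_nonneg (holderConst_nonneg _)] at h1
  obtain ⟨C, hC, hC'⟩ := exists_lt_of_csInf_lt hΨ ((ENNReal.ofReal_lt_ofReal_iff hε).1 h1)
  exact ⟨C, hC', hC⟩

end Distances

/-! ### Uniform closeness to a one-step map. -/

section Close

variable {d : ℕ} {M : Type*} [MetricSpace M] {ν α : ℝ}

/-- `Ψ` is uniformly `η`-close to `Φ`, and its fibre maps have Hölder constant at most `η`. -/
structure C0Close (ν α η : ℝ) (Φ Ψ : SkewProduct d M) : Prop where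
  dist_le : ∀ ξ x, dist (Φ.fib ξ x) (Ψ.fib ξ x) ≤ η
  holder : IsHolderBound ν α univ Ψ η

theorem C0Close.nonneg {η : ℝ} {Φ Ψ : SkewProduct d M} (h : C0Close ν α η Φ Ψ) : 0 ≤ η :=
  h.holder.1

theorem IsHolderBound.mono {D D' : Set M} {Φ : SkewProduct d M} {C C' : ℝ} (hν : 0 < ν)
    (h : IsHolderBound ν α D Φ C) (hD : D' ⊆ D) (hC : C ≤ C') : IsHolderBound ν α D' Φ C' := by
  refine ⟨h.1.trans hC, fun ξ ζ h0 x hx => ?_⟩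
  have h1 := h.2 ξ ζ h0 x (closure_mono hD hx)
  have h2 : C * seqDist ν ξ ζ ^ α ≤ C' * seqDist ν ξ ζ ^ α :=
    mul_le_mul_of_nonneg_right hC (Real.rpow_nonneg (seqDist_nonneg hν _ _) _)
  exact ⟨h1.1.trans h2, h1.2.trans h2⟩

theorem IsHolderBound.inverse {D : Set M} {Φ : SkewProduct d M} {C : ℝ}
    (h : IsHolderBound ν α D Φ C) : IsHolderBound ν α D Φ.inverse C := by
  refine ⟨h.1, fun ξ ζ h0 x hx => ?_⟩
  have := h.2 (conjSeq ξ) (conjSeq ζ) (by simpa [conjSeq] using h0) x hx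
  rw [seqDist_conjSeq] at this
  exact ⟨this.2, this.1⟩

theorem C0Close.mono {η η' : ℝ} {Φ Ψ : SkewProduct d M} (hν : 0 < ν) (h : C0Close ν α η Φ Ψ)
    (hη : η ≤ η') : C0Close ν α η' Φ Ψ :=
  ⟨fun ξ x => (h.dist_le ξ x).trans hη, h.holder.mono hν Subset.rfl hη⟩

/-- The two preimages of `x` have images under the fibre map of `Φ` at distance at most `η`, and its
inverse expands by at most `K`. Hölder bounds are symmetric in a map and its inverse; `1 ≤ K` fits
them under `K * η`. -/
theorem C0Close.inverse {η K : ℝ} {Φ Ψ : SkewProduct d M} (hν : 0 < ν) (h : C0Close ν α η Φ Ψ)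
    (hK : 1 ≤ K) (hΦ : ∀ ξ x y, dist x y ≤ K * dist (Φ.fib ξ x) (Φ.fib ξ y)) :
    C0Close ν α (K * η) Φ.inverse Ψ.inverse := by
  refine ⟨fun ξ x => ?_, h.holder.inverse.mono hν Subset.rfl (le_mul_of_one_le_left h.nonneg hK)⟩
  have h1 := hΦ (conjSeq ξ) ((Φ.fib (conjSeq ξ)).symm x) ((Ψ.fib (conjSeq ξ)).symm x)
  have h2 := h.dist_le (conjSeq ξ) ((Ψ.fib (conjSeq ξ)).symm x)
  rw [Homeomorph.apply_symm_apply] at h1 h2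
  rw [dist_comm] at h2
  exact h1.trans (mul_le_mul_of_nonneg_left h2 (by linarith))

theorem inverse_oneStep (φ : Fin d → M ≃ₜ M) :
    (oneStep φ).inverse = oneStep fun i => (φ i).symm := rfl

theorem C0Close.restrict {k l : ℕ} {η : ℝ} {Φ Ψ : SkewProduct (k + l) M}
    (h : C0Close ν α η Φ Ψ) :
    C0Close ν α η (Φ.restrict (k := k) (l := l)) (Ψ.restrict (k := k) (l := l)) := by
  refine ⟨fun ξ x => h.dist_le _ x, h.nonneg, fun ξ ζ h0 x hx => ?_⟩
  have := h.holder.2 (inclSeq k l ξ) (inclSeq k l ζ) (by simp [inclSeq, h0]) x hx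
  rwa [seqDist_inclSeq] at this

theorem C0Close.s0Dist_le (hν : 0 < ν) {D : Set M} {η : ℝ} {φ : Fin d → M ≃ₜ M}
    {Ψ : SkewProduct d M} (h : C0Close ν α η (oneStep φ) Ψ) :
    s0Dist ν α D (oneStep φ) Ψ ≤ ENNReal.ofReal η + ENNReal.ofReal η := by
  refine add_le_add (iSup_le fun ξ => iSup₂_le fun x _ => ?_) (ENNReal.ofReal_le_ofReal ?_)
  · rw [edist_dist]; exact ENNReal.ofReal_le_ofReal (h.dist_le ξ x)
  · rw [holderConst_oneStep hν, zero_sub, abs_neg, abs_of_nonneg (holderConst_nonneg _)]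
    exact holderConst_le (h.holder.mono hν (subset_univ _) le_rfl)

theorem exists_image_closure_subset [CompactSpace M] {k : ℕ} {ι : Fin k → Fin d}
    {φ : Fin d → M ≃ₜ M} {D : Set M} (hD : IsOpen D)
    (hφ : ∀ i, φ (ι i) '' closure D ⊆ D) :
    ∃ η > 0, ∀ Ψ : SkewProduct d M, C0Close ν α η (oneStep φ) Ψ →
      ∀ ξ : Seq d, ξ 0 ∈ range ι → Ψ.fib ξ '' closure D ⊆ D := by
  have h1 : IsCompact (⋃ i, φ (ι i) '' closure D) :=
    isCompact_iUnion fun i => isClosed_closure.isCompact.image (φ (ι i)).continuous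
  obtain ⟨η, hη, hη'⟩ := h1.exists_thickening_subset_open hD (iUnion_subset hφ)
  refine ⟨η / 2, half_pos hη, fun Ψ hΨ ξ ⟨i, hi⟩ => ?_⟩
  rintro _ ⟨x, hx, rfl⟩
  refine hη' (Metric.mem_thickening_iff.2 ⟨φ (ι i) x, mem_iUnion.2 ⟨i, mem_image_of_mem _ hx⟩, ?_⟩)
  have := hΨ.dist_le ξ x
  simp only [oneStep] at this
  rw [dist_comm, hi]
  linarith

end Close

/-! ### Blenders from covering. -/

section Blender

variable {k : ℕ} {M : Type*} [MetricSpace M] [CompactSpace M] {ν α : ℝ}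

/-- The backward orbit of the point found on the disk stays in `B` by covering, the forward orbit in
`closure D` by trapping. So the disk meets the maximal invariant set itself. -/
theorem exists_localUUSet_inter_nonempty
    (hball : ∀ (z : M) (r : ℝ), IsPreconnected (Metric.ball z r))
    (hν : 0 < ν) (hν1 : ν < 1) (hα : 0 ≤ α) {lam : ℝ} (hlam : ν ^ α < lam)
    {f : Fin k → M ≃ₜ M} {D B : Set M} (hB : IsOpen B) (hBD : B ⊆ D)
    (hcov : closure B ⊆ ⋃ i, f i '' B) :
    ∃ δ > (0 : ℝ), ∃ ε > (0 : ℝ), ∀ Ψ : SkewProduct k M,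
      (∀ ξ, ∀ x ∈ closure D, ∀ y ∈ closure D,
        lam * dist x y ≤ dist (Ψ.fib ξ x) (Ψ.fib ξ y)) →
      (∀ ξ, Ψ.fib ξ '' closure D ⊆ D) → (∃ C, IsHolderBound ν α D Ψ C) →
      s0Dist ν α D (oneStep f) Ψ < ENNReal.ofReal ε →
      ∀ H, IsHorizontalDisk ν α δ B H → (Ψ.localUUSet (Ψ.maxInv D) ∩ H).Nonempty := by
  obtain ⟨δ, hδ, hcovδ⟩ := exists_covering_perturbation hball f hB hcov
  have hνα : 0 < ν ^ α := Real.rpow_pos_of_pos hν α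
  have hlam0 : 0 < lam := hνα.trans hlam
  -- The largest Hölder defect `c` with `lam⁻¹ * ν ^ α * δ + c * ν ^ α ≤ δ`.
  set c := δ * (1 - lam⁻¹ * ν ^ α) / ν ^ α with hc
  have hLν : lam⁻¹ * ν ^ α < 1 := by
    rw [inv_mul_lt_iff₀ hlam0]; simpa using hlam
  have hc0 : 0 < c := div_pos (mul_pos hδ (by linarith)) hνα
  refine ⟨δ, hδ, min δ c, lt_min hδ hc0, fun Ψ hlip hcon hhol hdist H hH => ?_⟩
  obtain ⟨C, hC, hCb⟩ := exists_isHolderBound_lt hν (lt_min hδ hc0) hdist hhol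
  have hBD' : B ⊆ closure D := hBD.trans subset_closure
  obtain ⟨ζ, z, C₁, h, hz, hC₁, hhz, hhC, hCδ, rfl⟩ := hH
  have hcδ : c * ν ^ α = δ * (1 - lam⁻¹ * ν ^ α) := by rw [hc]; field_simp
  obtain ⟨ξ, hξ, -, horb⟩ := exists_backward_orbit (Ψ := Ψ) (ι := id) (δ := δ) (L := lam⁻¹)
    (c := c) (B := B) (ζ := ζ) (h := h) hν hν1 hα (inv_pos.2 hlam0) hc0.le
    (by
      intro z hz
      obtain ⟨i, hi⟩ := hcovδ z (subset_closure hz)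
      refine ⟨i, fun ξ hξ w hw => hi (Ψ.fib ξ) (fun x hx => ?_) w hw⟩
      have := dist_fib_lt_of_s0Dist_lt hdist ξ (closure_mono hBD hx)
      simp only [oneStep, hξ, id] at this
      exact this.trans_le (min_le_left _ _))
    (by
      intro ξ _ a b ha hb
      have := hlip ξ _ (hBD' ha) _ (hBD' hb)
      rw [Homeomorph.apply_symm_apply, Homeomorph.apply_symm_apply] at this
      rwa [inv_mul_eq_div, le_div_iff₀ hlam0, mul_comm])
    (by
      intro ξ ζ h0 x hx
      refine (hCb.2 ξ ζ h0 x (hBD' hx)).2.trans ?_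
      have := Real.rpow_nonneg (seqDist_nonneg hν ξ ζ) α
      exact mul_le_mul_of_nonneg_right (hC.le.trans (min_le_right _ _)) this)
    (by rw [hcδ]; linarith)
    ⟨⟨z, hz, hhz⟩, C₁, hC₁, hhC, hCδ⟩
  refine ⟨(ξ, h ξ), mem_iUnion₂.2 ⟨(ξ, h ξ), mem_maxInv.2 ?_, mem_localUU_self _ _⟩,
    mem_image_of_mem _ hξ⟩
  have hfwd : ∀ n : ℕ, ((Ψ.map ^ (n : ℤ)) (ξ, h ξ)).2 ∈ closure D := by
    intro n
    induction n with
    | zero => simpa using hBD' (horb 0)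
    | succ n ih =>
      push_cast
      rw [map_zpow_add_one]
      exact subset_closure (hcon _ (mem_image_of_mem _ ih))
  intro n
  obtain ⟨m, rfl | rfl⟩ := n.eq_nat_or_neg
  · exact hfwd m
  · exact hBD' (horb m)

variable {n : ℕ} [ChartedSpace (EuclideanSpace ℝ (Fin n)) M]

theorem memS_zero_of_image_subset {Ψ : SkewProduct k M} {D : Set M} {lam bet C : ℝ} (hk : 2 ≤ k)
    (hα : 0 ≤ α) (hα1 : α ≤ 1) (hlam : 0 < lam) (hlb : lam < bet) (hD : IsOpen D)
    (hlip : ∀ ξ, IsBiLipschitzOn lam bet (Ψ.fib ξ) (closure D)) (hC : IsHolderBound ν α D Ψ C)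
    (hcon : bet < 1 → ∀ ξ, Ψ.fib ξ '' closure D ⊆ D)
    (hexp : 1 < lam → ∀ ξ, closure D ⊆ Ψ.fib ξ '' D) : MemS n 0 ν α lam bet D Ψ where
  two_le := hk
  alpha_nonneg := hα
  alpha_le_one := hα1
  lam_pos := hlam
  lam_lt_bet := hlb
  isOpen := hD
  isBounded := Metric.isBounded_of_compactSpace
  contMDiff ξ := contMDiff_zero_iff.2 (Ψ.fib ξ).continuous
  contMDiff_symm ξ := contMDiff_zero_iff.2 (Ψ.fib ξ).symm.continuous
  lipschitz := hlip
  holder := ⟨C, hC⟩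
  contracting := hcon
  expanding := hexp

/-- The lower bound `lam₀` is fixed in advance so that one `η` serves all constants `lam`, `bet`
that a perturbation may have. -/
theorem exists_isCsBlender
    (hball : ∀ (z : M) (r : ℝ), IsPreconnected (Metric.ball z r))
    (hν : 0 < ν) (hν1 : ν < 1) (hα : 0 < α) (hα1 : α ≤ 1) (hk : 2 ≤ k) {lam₀ : ℝ}
    (hlam : ν ^ α < lam₀)
    {f : Fin k → M ≃ₜ M} {D B : Set M} (hD : IsOpen D) (hB : IsOpen B) (hBne : B.Nonempty)
    (hBD : B ⊆ D) (hcov : closure B ⊆ ⋃ i, f i '' B) (hf : ∀ i, f i '' closure D ⊆ D) :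
    ∃ η > (0 : ℝ), ∀ (Ψ : SkewProduct k M), C0Close ν α η (oneStep f) Ψ →
      (∀ ξ, Ψ.fib ξ '' closure D ⊆ D) ∧ ∀ lam bet, lam₀ ≤ lam → lam < bet → bet < 1 →
      (∀ ξ, IsBiLipschitzOn lam bet (Ψ.fib ξ) (closure D)) →
      IsCsBlender n ν α lam bet D Ψ B := by
  obtain ⟨δ, hδ, ε, hε, H⟩ := exists_localUUSet_inter_nonempty hball hν hν1 hα.le hlam hB hBD hcov
  obtain ⟨η, hη, hcon⟩ := exists_image_closure_subset (ν := ν) (α := α) (ι := id) (φ := f) hD hf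
  -- The closeness counts twice in `s0Dist`, in the maps and in the Hölder constants. This leaves `ε
  -- / 2` for the neighbourhood of `Ψ` in the definition of a blender.
  refine ⟨min η (ε / 4), by positivity, fun Ψ hΨ => ?_⟩
  have hΨcon := fun ξ => hcon Ψ (hΨ.mono hν (min_le_left _ _)) ξ (by simp)
  refine ⟨hΨcon, fun lam bet hl hlb hb hlip => ?_⟩
  have hlam0 : 0 < lam := (Real.rpow_pos_of_pos hν α).trans (hlam.trans_le hl)
  refine ⟨memS_zero_of_image_subset hk hα.le hα1 hlam0 hlb hD hlip
    (hΨ.holder.mono hν (subset_univ _) le_rfl) (fun _ => hΨcon) (fun h => by linarith), hb, hα, hB,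
    hBne, hBD, δ, hδ, ENNReal.ofReal (ε / 2), by simpa using hε, fun Θ hΘ hdist => ?_⟩
  refine H Θ (fun ξ x hx y hy => ?_) (hΘ.contracting hb) hΘ.holder ?_
  · rcases eq_or_ne x y with rfl | hxy
    · simp
    · exact (mul_le_mul_of_nonneg_right hl dist_nonneg).trans (hΘ.lipschitz ξ x hx y hy hxy).1.le
  · refine (s0Dist_triangle _ Ψ _).trans_lt ?_
    have h1 := hΨ.s0Dist_le hν (D := D)
    have h2 : min η (ε / 4) ≤ ε / 4 := min_le_right _ _
    calc _ < (ENNReal.ofReal (ε / 4) + ENNReal.ofReal (ε / 4)) + ENNReal.ofReal (ε / 2) := by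
          refine ENNReal.add_lt_add_of_le_of_lt ?_ (h1.trans (by gcongr)) hdist
          exact (h1.trans_lt (by simp)).ne
      _ = ENNReal.ofReal ε := by
          rw [← ENNReal.ofReal_add, ← ENNReal.ofReal_add] <;> first | positivity | (congr 1; ring)

/-- Inversion turns the upper Lipschitz bound `bet` into the lower bound `bet⁻¹`, and `bet₀ < ν ^
(-α)` into `ν ^ α < bet₀⁻¹`. Since preimages of `closure D` lie in `D`, the Lipschitz bounds on
`closure D` can be inverted there. -/
theorem exists_isCuBlender
    (hball : ∀ (z : M) (r : ℝ), IsPreconnected (Metric.ball z r))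
    (hν : 0 < ν) (hν1 : ν < 1) (hα : 0 < α) (hα1 : α ≤ 1) (hk : 2 ≤ k) {bet₀ : ℝ}
    (hbet : 0 < bet₀) (hbet' : bet₀ < ν ^ (-α))
    {f : Fin k → M ≃ₜ M} {K : ℝ} (hK : 1 ≤ K) (hfK : ∀ i x y, dist x y ≤ K * dist (f i x) (f i y))
    {D B : Set M} (hD : IsOpen D) (hB : IsOpen B) (hBne : B.Nonempty)
    (hBD : B ⊆ D) (hcov : closure B ⊆ ⋃ i, (f i).symm '' B)
    (hf : ∀ i, closure D ⊆ f i '' D) :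
    ∃ η > (0 : ℝ), ∀ (Ψ : SkewProduct k M), C0Close ν α η (oneStep f) Ψ →
      ∀ lam bet, bet ≤ bet₀ → lam < bet → 1 < lam →
      (∀ ξ, IsBiLipschitzOn lam bet (Ψ.fib ξ) (closure D)) →
      IsCuBlender n ν α lam bet D Ψ B := by
  have hνα : 0 < ν ^ α := Real.rpow_pos_of_pos hν α
  have hb0 : ν ^ α < bet₀⁻¹ := by
    rw [Real.rpow_neg hν.le] at hbet'
    exact (lt_inv_comm₀ hbet hνα).1 hbet'
  obtain ⟨η, hη, H⟩ := exists_isCsBlender (n := n) (f := fun i => (f i).symm) hball hν hν1 hα hα1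
    hk hb0 hD hB hBne hBD hcov (by
      rintro i _ ⟨x, hx, rfl⟩
      obtain ⟨y, hy, rfl⟩ := hf i hx
      simpa using hy)
  have hK0 : 0 < K := by linarith
  refine ⟨η / K, by positivity, fun Ψ hΨ lam bet hb hlb hl hlip => ?_⟩
  have hinv : C0Close ν α η (oneStep fun i => (f i).symm) Ψ.inverse := by
    have := hΨ.inverse hν hK fun ξ x y => hfK _ x y
    rwa [mul_div_cancel₀ _ hK0.ne', inverse_oneStep] at this
  obtain ⟨hcon, H⟩ := H _ hinv
  have hcon' : ∀ ξ, ∀ x ∈ closure D, (Ψ.fib ξ).symm x ∈ D := by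
    intro ξ x hx
    have := hcon (conjSeq ξ) (mem_image_of_mem _ hx)
    have e : conjSeq (conjSeq ξ) = ξ := by funext i; simp [conjSeq]
    simpa only [SkewProduct.inverse, e] using this
  have hlam0 : 0 < lam := by linarith
  have hbet0 : 0 < bet := by linarith
  refine ⟨memS_zero_of_image_subset hk hα.le hα1 hlam0 hlb hD hlip
    (hΨ.holder.mono hν (subset_univ _) le_rfl) (fun h => by linarith)
    (fun _ ξ x hx => ⟨_, hcon' ξ x hx, by simp⟩), hl,
    H _ _ (inv_anti₀ hbet0 hb) (inv_strictAnti₀ hlam0 hlb) (inv_lt_one_of_one_lt₀ hl)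
      fun ξ x hx y hy hxy => ?_⟩
  have h1 := hlip (conjSeq ξ) _ (subset_closure (hcon' (conjSeq ξ) x hx)) _
    (subset_closure (hcon' (conjSeq ξ) y hy)) (by simpa using hxy)
  rw [Homeomorph.apply_symm_apply, Homeomorph.apply_symm_apply] at h1
  constructor
  · rw [inv_mul_lt_iff₀ hbet0]; exact h1.2
  · rw [lt_inv_mul_iff₀ hlam0]; exact h1.1

end Blender

end SkewProduct

theorem tendsto_seqDist {d : ℕ} {ν : ℝ} (hν : 0 < ν) (hν1 : ν < 1) {β : Type*} {F : Filter β}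
    {u : β → Seq d} {θ : Seq d} (h : Tendsto u F (𝓝 θ)) :
    Tendsto (fun b => seqDist ν (u b) θ) F (𝓝 0) := by
  rw [Metric.tendsto_nhds]
  intro ε hε
  obtain ⟨N, hN⟩ := exists_pow_lt_of_lt_one hε hν1
  have h1 : ∀ᶠ b in F, ∀ i ∈ Finset.Ioo (-(N : ℤ)) N, u b i = θ i :=
    (Finset.eventually_all _).2 fun i _ =>
      (tendsto_pi_nhds.1 h i).eventually_mem ((isOpen_discrete {θ i}).mem_nhds rfl)
  filter_upwards [h1] with b hb
  rw [Real.dist_0_eq_abs, abs_of_nonneg (seqDist_nonneg hν _ _)]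
  refine (seqDist_le_pow hν hν1 fun i hi => hb i ?_).trans_lt hN
  rw [abs_lt] at hi
  exact Finset.mem_Ioo.2 hi

namespace SkewProduct

/-! ### Continuity of iterates and the subsystem on the first `k` symbols. -/

section Invariant

variable {k l : ℕ} {M : Type*} [TopologicalSpace M]

theorem continuous_shift (d : ℕ) : Continuous (shift d) :=
  continuous_pi fun i => continuous_apply (i + 1)

theorem continuous_shift_symm (d : ℕ) : Continuous (shift d).symm :=
  continuous_pi fun i => continuous_apply (i - 1)

theorem continuous_map_zpow {d : ℕ} (Ψ : SkewProduct d M) (n : ℤ) : Continuous (Ψ.map ^ n) := by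
  have h1 : Continuous Ψ.map :=
    ((continuous_shift d).comp continuous_fst).prodMk Ψ.continuous_fib
  have h2 : Continuous (Ψ.map⁻¹ : Equiv.Perm _) := by
    have h3 : Continuous fun p : Seq d × M => ((shift d).symm p.1, p.2) :=
      ((continuous_shift_symm d).comp continuous_fst).prodMk continuous_snd
    exact ((continuous_shift_symm d).comp continuous_fst).prodMk (Ψ.continuous_fib_symm.comp h3)
  induction n with
  | zero => exact continuous_id
  | succ n ih => rw [zpow_add_one]; exact ih.comp h1
  | pred n ih => rw [zpow_sub_one]; exact ih.comp h2

theorem map_zpow_restrict (Ψ : SkewProduct (k + l) M) (n : ℤ) (p : Seq k × M) :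
    (Ψ.map ^ n) (inclSeq k l p.1, p.2) =
      (inclSeq k l (((Ψ.restrict (k := k) (l := l)).map ^ n) p).1,
        (((Ψ.restrict (k := k) (l := l)).map ^ n) p).2) := by
  induction n with
  | zero => simp
  | succ n ih => rw [map_zpow_add_one, map_zpow_add_one, ih]; rfl
  | pred n ih => rw [map_zpow_sub_one, map_zpow_sub_one, ih]; rfl

theorem map_image_subMaxInv (Ψ : SkewProduct (k + l) M) (D : Set M) :
    Ψ.map '' subMaxInv (k := k) (l := l) D Ψ = subMaxInv (k := k) (l := l) D Ψ := by
  have h : ∀ p : Seq k × M, Ψ.map (inclSeq k l p.1, p.2) =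
      (inclSeq k l ((Ψ.restrict (k := k) (l := l)).map p).1,
        ((Ψ.restrict (k := k) (l := l)).map p).2) := fun p => map_zpow_restrict Ψ 1 p
  unfold subMaxInv
  conv_rhs => rw [← map_image_maxInv]
  rw [image_image, image_image]
  simp only [h]

theorem mem_subMaxInv {Ψ : SkewProduct (k + l) M} {D : Set M} {p : Seq (k + l) × M}
    (h : ∀ n : ℤ, ((Ψ.map ^ n) p).2 ∈ closure D ∧ p.1 n ∈ range (Fin.castAdd (n := k) l)) :
    p ∈ subMaxInv (k := k) (l := l) D Ψ := by
  choose θ hθ using fun n => (h n).2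
  have hp : p = (inclSeq k l θ, p.2) := Prod.ext (funext fun n => (hθ n).symm) rfl
  refine ⟨(θ, p.2), mem_maxInv.2 fun n => ?_, hp.symm⟩
  have h1 := (h n).1
  rw [hp, map_zpow_restrict Ψ n (θ, p.2)] at h1
  exact h1

end Invariant

/-! ### Stable and unstable sets from confined orbits. -/

section StableSets

variable {k l : ℕ} {M : Type*} [MetricSpace M] [CompactSpace M] {ν : ℝ}

/-- `Σ × M` is compact, so the orbit converges along every ultrafilter. Confinement to `closure D`
and to the first `k` symbols are closed conditions, inherited by all iterates of the limit, which
therefore lies in the invariant set and bounds the distance. The general filter and times `u` cover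
both directions of time. -/
theorem tendsto_distToSet_subMaxInv (hν : 0 < ν) (hν1 : ν < 1) (Ψ : SkewProduct (k + l) M)
    {D : Set M} {p : Seq (k + l) × M} {β : Type*} {F : Filter β} (u : β → ℤ)
    (h : ∀ m : ℤ, ∀ᶠ j in F, ((Ψ.map ^ (m + u j)) p).2 ∈ closure D ∧
      p.1 (m + u j) ∈ range (Fin.castAdd (n := k) l)) :
    Tendsto (fun j => distToSet ν ((Ψ.map ^ u j) p) (subMaxInv (k := k) (l := l) D Ψ)) F
      (𝓝 0) := by
  rw [tendsto_iff_ultrafilter]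
  intro G hG
  have hlim : Tendsto (fun j => (Ψ.map ^ u j) p) G
      (𝓝 (G.map fun j => (Ψ.map ^ u j) p).lim) := (G.map fun j => (Ψ.map ^ u j) p).le_nhds_lim
  set q := (G.map fun j => (Ψ.map ^ u j) p).lim
  have hq : q ∈ subMaxInv (k := k) (l := l) D Ψ := by
    refine mem_subMaxInv fun m => ⟨?_, ?_⟩
    · refine isClosed_closure.mem_of_tendsto
        ((continuous_snd.tendsto _).comp (((Ψ.continuous_map_zpow m).tendsto q).comp hlim)) ?_
      filter_upwards [(h m).filter_mono hG] with j hj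
      simpa only [Function.comp, ← map_zpow_add] using hj.1
    · refine (isClosed_discrete (range (Fin.castAdd (n := k) l))).mem_of_tendsto
        (((continuous_apply m).tendsto _).comp ((continuous_fst.tendsto q).comp hlim)) ?_
      filter_upwards [(h m).filter_mono hG] with j hj
      simpa only [Function.comp, map_zpow_fst_apply] using hj.2
  have h1 : Tendsto (fun j => ENNReal.ofReal (seqDist ν ((Ψ.map ^ u j) p).1 q.1) +
      edist ((Ψ.map ^ u j) p).2 q.2) G (𝓝 0) := by
    have h2 := ENNReal.tendsto_ofReal
      (tendsto_seqDist hν hν1 ((continuous_fst.tendsto q).comp hlim))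
    have h3 := tendsto_iff_edist_tendsto_0.1 ((continuous_snd.tendsto q).comp hlim)
    simpa using h2.add h3
  exact tendsto_of_tendsto_of_tendsto_of_le_of_le tendsto_const_nhds h1 (fun _ => zero_le)
    fun j => iInf₂_le q hq

theorem mem_stableSet_subMaxInv (hν : 0 < ν) (hν1 : ν < 1) (Ψ : SkewProduct (k + l) M)
    {D : Set M} {p : Seq (k + l) × M} (N : ℤ)
    (h : ∀ n : ℤ, N ≤ n → ((Ψ.map ^ n) p).2 ∈ closure D ∧
      p.1 n ∈ range (Fin.castAdd (n := k) l)) :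
    p ∈ Ψ.stableSet ν (subMaxInv (k := k) (l := l) D Ψ) := by
  refine tendsto_distToSet_subMaxInv hν hν1 Ψ (fun j : ℕ => (j : ℤ)) fun m => ?_
  filter_upwards [eventually_ge_atTop (N - m).toNat] with j hj
  exact h _ (by omega)

theorem mem_unstableSet_subMaxInv (hν : 0 < ν) (hν1 : ν < 1) (Ψ : SkewProduct (k + l) M)
    {D : Set M} {p : Seq (k + l) × M} (N : ℤ)
    (h : ∀ n : ℤ, n < N → ((Ψ.map ^ n) p).2 ∈ closure D ∧
      p.1 n ∈ range (Fin.castAdd (n := k) l)) :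
    p ∈ Ψ.unstableSet ν (subMaxInv (k := k) (l := l) D Ψ) := by
  refine tendsto_distToSet_subMaxInv hν hν1 Ψ (fun j : ℕ => -(j : ℤ)) fun m => ?_
  filter_upwards [eventually_gt_atTop (m - N).toNat] with j hj
  exact h _ (by omega)

end StableSets

/-! ### The robust connection from `D_cu` to `D_cs`. -/

section Transverse

variable {d : ℕ} {M : Type*} [MetricSpace M] {ν α : ℝ}

theorem exists_dist_iterate_lt (hν : 0 < ν) (φ : Fin d → M ≃ₜ M) (a : Fin d) (y : M) (q : ℕ)
    {ε : ℝ} (hε : 0 < ε) : ∃ η > 0, ∀ Ψ : SkewProduct d M, C0Close ν α η (oneStep φ) Ψ →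
      ∀ ξ : Seq d, (∀ i : ℤ, 0 ≤ i → i < q → ξ i = a) →
        dist ((Ψ.map ^ (q : ℤ)) (ξ, y)).2 ((φ a)^[q] y) < ε := by
  induction q generalizing ε with
  | zero => exact ⟨1, one_pos, fun Ψ _ ξ _ => by simpa using hε⟩
  | succ q ih =>
    obtain ⟨ε', hε', hcont⟩ := Metric.continuous_iff.1 (φ a).continuous ((φ a)^[q] y) (ε / 2)
      (half_pos hε)
    obtain ⟨η, hη, H⟩ := ih hε'
    refine ⟨min η (ε / 2), by positivity, fun Ψ hΨ ξ hξ => ?_⟩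
    have h1 := H Ψ (hΨ.mono hν (min_le_left _ _)) ξ fun i h0 hi => hξ i h0 (by push_cast; omega)
    have h2 := hcont _ h1
    have h3 := hΨ.dist_le ((Ψ.map ^ (q : ℤ)) (ξ, y)).1 ((Ψ.map ^ (q : ℤ)) (ξ, y)).2
    have h4 : ((Ψ.map ^ (q : ℤ)) (ξ, y)).1 0 = a := by
      rw [map_zpow_fst_apply]; exact hξ _ (by omega) (by push_cast; omega)
    simp only [oneStep, h4] at h3
    push_cast
    rw [map_zpow_add_one, Function.iterate_succ_apply']
    have h5 := min_le_right η (ε / 2)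
    have h6 := dist_triangle_left (Ψ.map ((Ψ.map ^ (q : ℤ)) (ξ, y))).2 (φ a ((φ a)^[q] y))
      (φ a ((Ψ.map ^ (q : ℤ)) (ξ, y)).2)
    rw [map_apply] at h6 ⊢
    linarith

variable [CompactSpace M]

theorem exists_symm_image_closure_subset (hν : 0 < ν) {k : ℕ} {ι : Fin k → Fin d}
    {φ : Fin d → M ≃ₜ M} {K : ℝ} (hK : 1 ≤ K)
    (hφK : ∀ i x y, dist x y ≤ K * dist (φ i x) (φ i y)) {D : Set M} (hD : IsOpen D)
    (hφ : ∀ i, closure D ⊆ φ (ι i) '' D) :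
    ∃ η > 0, ∀ Ψ : SkewProduct d M, C0Close ν α η (oneStep φ) Ψ →
      ∀ ξ : Seq d, ξ 0 ∈ range ι → ∀ x ∈ closure D, (Ψ.fib ξ).symm x ∈ D := by
  obtain ⟨η, hη, H⟩ := exists_image_closure_subset (ν := ν) (α := α) (ι := ι)
    (φ := fun i => (φ i).symm) hD (by
      rintro i _ ⟨x, hx, rfl⟩
      obtain ⟨y, hy, rfl⟩ := hφ i hx
      simpa using hy)
  have hK0 : 0 < K := by linarith
  refine ⟨η / K, by positivity, fun Ψ hΨ ξ hξ x hx => ?_⟩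
  have hinv := hΨ.inverse hν hK fun ξ x y => hφK _ x y
  rw [mul_div_cancel₀ _ hK0.ne', inverse_oneStep] at hinv
  have := H _ hinv (conjSeq ξ) (by simpa [conjSeq] using hξ) (mem_image_of_mem _ hx)
  have e : conjSeq (conjSeq ξ) = ξ := by funext i; simp [conjSeq]
  simpa only [SkewProduct.inverse, e] using this

/-- Landing in the open set `Dcs` after `q` steps persists under perturbation. Before the transition
`Dcu` traps the backward orbit, after it `Dcs` traps the forward orbit, whatever the symbols below
`k` are. -/
theorem exists_stableSet_inter_unstableSet (hν : 0 < ν) (hν1 : ν < 1) {k l : ℕ} (hk : 0 < k)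
    {φ : Fin (k + l) → M ≃ₜ M} {K : ℝ} (hK : 1 ≤ K)
    (hφK : ∀ i x y, dist x y ≤ K * dist (φ i x) (φ i y)) {Dcs Dcu : Set M} (hDcs : IsOpen Dcs)
    (hDcu : IsOpen Dcu) (hcs : ∀ i : Fin k, φ (Fin.castAdd l i) '' closure Dcs ⊆ Dcs)
    (hcu : ∀ i : Fin k, closure Dcu ⊆ φ (Fin.castAdd l i) '' Dcu) {a : Fin (k + l)} {y : M}
    {q : ℕ} (hy : y ∈ Dcu) (hyq : (φ a)^[q] y ∈ Dcs) :
    ∃ η > 0, ∀ Ψ : SkewProduct (k + l) M, C0Close ν α η (oneStep φ) Ψ →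
      (Ψ.stableSet ν (subMaxInv (k := k) (l := l) Dcs Ψ) ∩
        Ψ.unstableSet ν (subMaxInv (k := k) (l := l) Dcu Ψ)).Nonempty := by
  obtain ⟨η₁, hη₁, H₁⟩ := exists_image_closure_subset (ν := ν) (α := α) hDcs hcs
  obtain ⟨η₂, hη₂, H₂⟩ := exists_symm_image_closure_subset (α := α) hν hK hφK hDcu hcu
  obtain ⟨ε, hε, hball⟩ := Metric.isOpen_iff.1 hDcs _ hyq
  obtain ⟨η₃, hη₃, H₃⟩ := exists_dist_iterate_lt (α := α) hν φ a y q hε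
  refine ⟨min η₁ (min η₂ η₃), by positivity, fun Ψ hΨ => ?_⟩
  replace H₁ := H₁ Ψ (hΨ.mono hν (min_le_left _ _))
  replace H₂ := H₂ Ψ (hΨ.mono hν ((min_le_right _ _).trans (min_le_left _ _)))
  replace H₃ := H₃ Ψ (hΨ.mono hν ((min_le_right _ _).trans (min_le_right _ _)))
  -- The symbol `a` is used exactly at times `0, …, q - 1`; at all other times the symbol `0`
  -- serves, which exists since `0 < k`.
  let ξ : Seq (k + l) := fun i => if 0 ≤ i ∧ i < q then a else Fin.castAdd l ⟨0, hk⟩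
  have hξr : ∀ i : ℤ, i < 0 ∨ (q : ℤ) ≤ i → ξ i ∈ range (Fin.castAdd (n := k) l) := by
    intro i hi
    have : ¬ (0 ≤ i ∧ i < q) := by omega
    exact ⟨⟨0, hk⟩, by simp [ξ, this]⟩
  have hfwd : ∀ n : ℕ, ((Ψ.map ^ ((q : ℤ) + n)) (ξ, y)).2 ∈ Dcs := by
    intro n
    induction n with
    | zero => simpa using hball (H₃ ξ fun i h0 hi => by simp [ξ, h0, hi])
    | succ n ih =>
      push_cast
      rw [← add_assoc, map_zpow_add_one]
      refine H₁ _ ?_ (mem_image_of_mem _ (subset_closure ih))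
      rw [map_zpow_fst_apply]
      exact hξr _ (by omega)
  have hbwd : ∀ n : ℕ, ((Ψ.map ^ (-(n : ℤ))) (ξ, y)).2 ∈ Dcu := by
    intro n
    induction n with
    | zero => simpa using hy
    | succ n ih =>
      push_cast
      rw [neg_add, ← sub_eq_add_neg, map_zpow_sub_one]
      refine H₂ _ ?_ _ (subset_closure ih)
      rw [shift_symm_apply, map_zpow_fst_apply]
      exact hξr _ (by omega)
  refine ⟨(ξ, y), mem_stableSet_subMaxInv hν hν1 Ψ q fun n hn => ⟨?_, hξr n (Or.inr hn)⟩,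
    mem_unstableSet_subMaxInv hν hν1 Ψ 0 fun n hn => ⟨?_, hξr n (Or.inl hn)⟩⟩
  · have := hfwd (n - q).toNat
    rw [Int.toNat_of_nonneg (by omega), add_sub_cancel] at this
    exact subset_closure this
  · have := hbwd (-n).toNat
    rw [Int.toNat_of_nonneg (by omega), neg_neg] at this
    exact subset_closure this

end Transverse

/-! ### Repeated pullback of constant disks. -/

section Pullback

variable {d : ℕ} {M : Type*} [MetricSpace M] {ν α : ℝ}

theorem map_zpow_pullback_iterate (Ψ : SkewProduct d M) (h : Seq d → M) (n : ℕ) (ξ : Seq d) :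
    (Ψ.map ^ (n : ℤ)) (ξ, Ψ.pullback^[n] h ξ) =
      (((shift d) ^ (n : ℤ)) ξ, h (((shift d) ^ (n : ℤ)) ξ)) := by
  induction n generalizing h with
  | zero => simp
  | succ n ih =>
    push_cast
    rw [map_zpow_add_one, Function.iterate_succ_apply, ih, map_pullback, add_comm (n : ℤ) 1,
      zpow_add, zpow_one, Equiv.Perm.mul_apply]

/-- `Ψ` is `η`-close to `Φ`, and its fibre maps differ from those of `Φ` by
`(1 + η)`-bi-Lipschitz maps. -/
structure LipClose (ν α η : ℝ) (Φ Ψ : SkewProduct d M) : Prop extends C0Close ν α η Φ Ψ where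
  le_mul : ∀ ξ x y, dist (Ψ.fib ξ x) (Ψ.fib ξ y) ≤ (1 + η) * dist (Φ.fib ξ x) (Φ.fib ξ y)
  mul_le : ∀ ξ x y, dist (Φ.fib ξ x) (Φ.fib ξ y) ≤ (1 + η) * dist (Ψ.fib ξ x) (Ψ.fib ξ y)

/-- `hLC` makes `C` an invariant bound for the graph transform, and a constant disk satisfies it
trivially; hence uniformity in `n`. The Lipschitz bound is global, so no confinement of the disks is
needed. -/
theorem holderOnStable_pullback_iterate (hν : 0 < ν) (hν1 : ν < 1) (hα : 0 ≤ α)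
    {Ψ : SkewProduct d M} {L η C : ℝ} (hL : 0 ≤ L) (hC : 0 ≤ C)
    (hΨL : ∀ ξ x y, dist x y ≤ L * dist (Ψ.fib ξ x) (Ψ.fib ξ y))
    (hη : IsHolderBound ν α univ Ψ η) (hLC : L * ν ^ α * C + η ≤ C) (θ : Seq d) (w : M) (n : ℕ) :
    HolderOnStable ν α C (((shift d) ^ (-(n : ℤ))) θ) (Ψ.pullback^[n] fun _ => w) := by
  induction n with
  | zero =>
    intro ξ _ ξ' _
    have := Real.rpow_nonneg (seqDist_nonneg hν ξ ξ') α
    simp only [Function.iterate_zero, id, dist_self]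
    positivity
  | succ n ih =>
    rw [Function.iterate_succ_apply']
    have e : shift d (((shift d) ^ (-((n + 1 : ℕ) : ℤ))) θ) = ((shift d) ^ (-(n : ℤ))) θ := by
      funext j; rw [shift_apply, shift_zpow_apply, shift_zpow_apply]; congr 1; push_cast; ring
    have := ih.pullback (ζ' := ((shift d) ^ (-((n + 1 : ℕ) : ℤ))) θ) hν hν1 hα (c := η) hC hL
      (by rw [e]; exact mem_stableSeq_self _)
      (fun ξ _ η _ => by simpa using hΨL ξ ((Ψ.fib ξ).symm _) ((Ψ.fib ξ).symm _))
      (fun ξ hξ ζ hζ => (hη.2 ξ ζ ((hξ 0 le_rfl).trans (hζ 0 le_rfl).symm) _ (by simp)).2)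
    intro ξ hξ ξ' hξ'
    refine (this ξ hξ ξ' hξ').trans ?_
    exact mul_le_mul_of_nonneg_right hLC (Real.rpow_nonneg (seqDist_nonneg hν _ _) _)

/-- One step back through the symbol `a` turns an error `E` into at most `K * (E + η)`, and `η ≤ e ≤
E` bounds this by `2 * K * E`. -/
theorem dist_pullback_iterate_le {φ : Fin d → M ≃ₜ M} {Ψ : SkewProduct d M} {η K e : ℝ}
    (hΨ : C0Close ν α η (oneStep φ) Ψ) (hK : 1 ≤ K)
    (hφK : ∀ i x y, dist x y ≤ K * dist (φ i x) (φ i y)) (he : η ≤ e) {a : Fin d} {x : M}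
    {h : Seq d → M} {p : ℕ} {θ : Seq d} (hθ : ∀ i : ℤ, i < 0 → θ i = a)
    (hh : ∀ ξ ∈ stableSeq θ, dist ((φ a)^[p] x) (h ξ) ≤ e) (j : ℕ) (hj : j ≤ p) :
    ∀ ξ ∈ stableSeq (((shift d) ^ (-(j : ℤ))) θ),
      dist ((φ a)^[p - j] x) (Ψ.pullback^[j] h ξ) ≤ (2 * K) ^ j * e := by
  induction j with
  | zero => simpa using hh
  | succ j ih =>
    intro ξ hξ
    have hξ' : shift d ξ ∈ stableSeq (((shift d) ^ (-(j : ℤ))) θ) := by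
      have := shift_mem_stableSeq hξ
      intro i hi
      rw [this i hi, shift_apply, shift_zpow_apply, shift_zpow_apply]
      congr 1; push_cast; ring
    have h1 := ih (by omega) _ hξ'
    have h0 : ξ 0 = a := by
      rw [hξ 0 le_rfl, shift_zpow_apply]; exact hθ _ (by push_cast; omega)
    have e1 : p - j = (p - (j + 1)) + 1 := by omega
    rw [e1, Function.iterate_succ_apply'] at h1
    rw [Function.iterate_succ_apply']
    set u := (φ a)^[p - (j + 1)] x
    have h2 := hφK a u (Ψ.pullback (Ψ.pullback^[j] h) ξ)
    have h3 := hΨ.dist_le ξ (Ψ.pullback (Ψ.pullback^[j] h) ξ)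
    have h4 : Ψ.fib ξ (Ψ.pullback (Ψ.pullback^[j] h) ξ) = Ψ.pullback^[j] h (shift d ξ) := by
      simp [pullback]
    rw [h4] at h3
    simp only [oneStep, h0] at h3
    have h5 := dist_triangle_right (φ a u) (φ a (Ψ.pullback (Ψ.pullback^[j] h) ξ))
      (Ψ.pullback^[j] h (shift d ξ))
    have h6 : 1 ≤ (2 * K) ^ j := one_le_pow₀ (by linarith)
    have he0 : 0 ≤ e := hΨ.nonneg.trans he
    calc _ ≤ K * ((2 * K) ^ j * e + e) := h2.trans (by gcongr; linarith)
      _ ≤ K * ((2 * K) ^ j * e + (2 * K) ^ j * e) := by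
        gcongr; exact le_mul_of_one_le_left he0 h6
      _ = (2 * K) ^ (j + 1) * e := by ring

end Pullback

/-! ### The robust connection from the cs- to the cu-blender. -/

section Heteroclinic

variable {k l : ℕ} {M : Type*} [MetricSpace M] {ν α : ℝ}

/-- The map `J` conjugates the inverse of `Ψ.inverse` to `Ψ`. Its extra shift compensates for `Ψ⁻¹`
using the fibre map at the previous symbol. -/
theorem inverse_map_zpow (Ψ : SkewProduct k M) (n : ℤ) (ξ : Seq k) (y : M) :
    ((Ψ.inverse.map ^ (-n)) (ξ, y)).2 = ((Ψ.map ^ n) (shift k (conjSeq ξ), y)).2 := by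
  let J : Seq k × M → Seq k × M := fun p => (shift k (conjSeq p.1), p.2)
  have hJ : ∀ p, Ψ.map (J p) = J (Ψ.inverse.map⁻¹ p) := by
    intro p
    have e : conjSeq ((shift k).symm p.1) = shift k (conjSeq p.1) := by
      funext i; simp only [conjSeq, shift_symm_apply, shift_apply, neg_add']
    simp only [J, map_apply, map_symm_apply, e]
    simp [SkewProduct.inverse, e]
  have hJn : ∀ n : ℤ, (Ψ.map ^ n) (J (ξ, y)) = J ((Ψ.inverse.map ^ (-n)) (ξ, y)) := by
    intro n
    induction n with
    | zero => simp
    | succ n ih => rw [map_zpow_add_one, ih, hJ, ← map_zpow_sub_one, neg_add, ← sub_eq_add_neg]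
    | pred n ih =>
      rw [map_zpow_sub_one, ih, Equiv.Perm.inv_eq_iff_eq, hJ, ← map_zpow_sub_one]
      congr 3; ring
  exact (congrArg Prod.snd (hJn n)).symm

variable [CompactSpace M]

/-- For `Ψ.inverse` this is a backward orbit of a point on the constant disk at height `y`.
Conjugation turns the prescribed constant future `a` into the past and the chosen symbols into the
future. -/
theorem exists_forward_orbit (hν : 0 < ν) (hν1 : ν < 1) (hα : 0 ≤ α)
    (hball : ∀ (z : M) (r : ℝ), IsPreconnected (Metric.ball z r)) {φ : Fin (k + l) → M ≃ₜ M}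
    {K : ℝ} (hK : 1 ≤ K) (hφK : ∀ i x y, dist x y ≤ K * dist (φ i x) (φ i y)) {B : Set M}
    (hB : IsOpen B) (hcov : closure B ⊆ ⋃ i : Fin k, (φ (Fin.castAdd l i)).symm '' B)
    {L : ℝ} (hL : 0 < L) (hLν : L * ν ^ α < 1) :
    ∃ η > 0, ∀ Ψ : SkewProduct (k + l) M, C0Close ν α η (oneStep φ) Ψ →
      (∀ ξ x y, dist (Ψ.fib ξ x) (Ψ.fib ξ y) ≤ L * dist x y) →
      ∀ y ∈ B, ∀ a : Fin (k + l), ∃ θ : Seq (k + l), (∀ i : ℤ, i < 0 → θ i = a) ∧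
        (∀ i : ℤ, 0 ≤ i → θ i ∈ range (Fin.castAdd (n := k) l)) ∧
        ∀ n : ℕ, ((Ψ.map ^ (n : ℤ)) (θ, y)).2 ∈ B := by
  obtain ⟨δ, hδ, H⟩ := exists_covering_perturbation hball
    (fun i : Fin k => (φ (Fin.castAdd l i)).symm) hB hcov
  have hνα : 0 < ν ^ α := Real.rpow_pos_of_pos hν α
  set c := δ * (1 - L * ν ^ α) / ν ^ α with hc
  have hc0 : 0 < c := div_pos (mul_pos hδ (by linarith)) hνα
  have hcδ : c * ν ^ α = δ * (1 - L * ν ^ α) := by rw [hc]; field_simp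
  have hK0 : 0 < K := by linarith
  -- Inversion loses the factor `K`; halving `δ` gives the strict inequality needed for the
  -- covering.
  refine ⟨min (δ / 2) c / K, by positivity, fun Ψ hΨ hlip y hy a => ?_⟩
  have hinv := hΨ.inverse hν hK fun ξ x y => hφK _ x y
  rw [mul_div_cancel₀ _ hK0.ne', inverse_oneStep] at hinv
  obtain ⟨ξ, hξ, hsym, horb⟩ := exists_backward_orbit (Ψ := Ψ.inverse)
    (ι := Fin.castAdd (n := k) l) (δ := δ) (L := L) (c := c) (B := B) (ζ := fun _ => a)
    (h := fun _ => y) hν hν1 hα hL hc0.le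
    (by
      intro z hz
      obtain ⟨i, hi⟩ := H z (subset_closure hz)
      refine ⟨i, fun ξ hξ w hw => hi (Ψ.inverse.fib ξ) (fun x _ => ?_) w hw⟩
      have := hinv.dist_le ξ x
      simp only [oneStep, hξ] at this
      refine this.trans_lt ((min_le_left _ _).trans_lt (half_lt_self hδ)))
    (fun ξ _ u v _ _ => hlip (conjSeq ξ) u v)
    (by
      intro ξ ζ h0 x _
      refine (hinv.holder.2 ξ ζ h0 x (by simp)).2.trans ?_
      exact mul_le_mul_of_nonneg_right (min_le_right _ _)
        (Real.rpow_nonneg (seqDist_nonneg hν ξ ζ) α))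
    (by rw [hcδ]; linarith)
    ⟨⟨y, hy, fun ξ _ => ⟨hy, by simpa using hδ⟩⟩, 0, le_rfl, fun ξ _ ξ' _ => by simp,
      by simpa using hδ⟩
  refine ⟨shift (k + l) (conjSeq ξ), fun i hi => ?_, fun i hi => ?_, fun n => ?_⟩
  · rw [shift_apply, conjSeq]; exact hξ _ (by omega)
  · have := hsym i.toNat
    rw [Int.toNat_of_nonneg hi] at this
    rw [shift_apply, conjSeq, neg_add]; exact this
  · rw [← inverse_map_zpow]; exact horb n

/-- The orbit from `exists_forward_orbit` begins at the exact point `(φ a)^[p] x`. Finite stretches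
of it are shadowed by disks, pulled back to `x` and treated by `exists_backward_orbit`. Working up
to time `N` and passing to a limit avoids constructing the strong stable leaf of that orbit. -/
theorem exists_unstableSet_inter_stableSet (hν : 0 < ν) (hν1 : ν < 1) (hα : 0 ≤ α)
    (hball : ∀ (z : M) (r : ℝ), IsPreconnected (Metric.ball z r)) {φ : Fin (k + l) → M ≃ₜ M}
    {K : ℝ} (hK : 1 ≤ K) (hKν : K * ν ^ α < 1)
    (hφK : ∀ i x y, dist x y ≤ K * dist (φ i x) (φ i y))
    (hφK' : ∀ i x y, dist (φ i x) (φ i y) ≤ K * dist x y) {Dcs Dcu Bcs Bcu : Set M}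
    (hDcu : IsOpen Dcu) (hcu : ∀ i : Fin k, closure Dcu ⊆ φ (Fin.castAdd l i) '' Dcu)
    (hBcs : IsOpen Bcs) (hBcu : IsOpen Bcu) (hBDcs : Bcs ⊆ Dcs) (hBDcu : Bcu ⊆ Dcu)
    (hcovcs : closure Bcs ⊆ ⋃ i : Fin k, φ (Fin.castAdd l i) '' Bcs)
    (hcovcu : closure Bcu ⊆ ⋃ i : Fin k, (φ (Fin.castAdd l i)).symm '' Bcu)
    {a : Fin (k + l)} {x : M} {p : ℕ} (hx : x ∈ Bcs) (hxp : (φ a)^[p] x ∈ Bcu) :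
    ∃ η > 0, ∀ Ψ : SkewProduct (k + l) M, LipClose ν α η (oneStep φ) Ψ →
      (Ψ.unstableSet ν (subMaxInv (k := k) (l := l) Dcs Ψ) ∩
        Ψ.stableSet ν (subMaxInv (k := k) (l := l) Dcu Ψ)).Nonempty := by
  have hνα : 0 < ν ^ α := Real.rpow_pos_of_pos hν α
  have hK0 : 0 < K := by linarith
  -- `L` exceeds `K` so as to absorb the distortion `1 + C` of a perturbation.
  obtain ⟨L, hKL, hLν⟩ : ∃ L, K < L ∧ L * ν ^ α < 1 := by
    obtain ⟨L, h1, h2⟩ := exists_between ((lt_div_iff₀ hνα).2 hKν)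
    exact ⟨L, h1, (lt_div_iff₀ hνα).1 h2⟩
  have hL0 : 0 < L := hK0.trans hKL
  obtain ⟨η₁, hη₁, H₁⟩ := exists_forward_orbit (α := α) hν hν1 hα hball hK hφK hBcu hcovcu hL0 hLν
  obtain ⟨δ, hδ, hcovδ⟩ := exists_covering_perturbation hball
    (fun i : Fin k => φ (Fin.castAdd l i)) hBcs hcovcs
  obtain ⟨r, hr, hball_r⟩ := Metric.isOpen_iff.1 hBcs x hx
  have hclBcu : closure Bcu ⊆ Dcu := by
    intro u hu
    obtain ⟨i, v, hv, rfl⟩ := mem_iUnion.1 (hcovcu hu)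
    obtain ⟨w, hw, hwv⟩ := hcu i (subset_closure (hBDcu hv))
    rwa [← hwv, Homeomorph.symm_apply_apply]
  obtain ⟨ρ, hρ, hthick⟩ := isClosed_closure.isCompact.exists_thickening_subset_open hDcu hclBcu
  set κ := 1 - L * ν ^ α with hκ
  have hκ0 : 0 < κ := by linarith
  have hκ1 : κ < 1 := by have : 0 < L * ν ^ α := by positivity
                         linarith
  -- the common Hölder constant of all the disks is `C`, and the perturbation has size `κ * C`
  set E := min (min r δ) (min ρ η₁) with hE
  have hE0 : 0 < E := by positivity
  -- The three terms keep the disk close to `x` after `p` pullbacks, keep shadowing errors below `E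
  -- / 2`, and ensure `(1 + C) * K ≤ L`.
  set C := min (E / 2 / (2 * K) ^ p) (min (E / 2) ((L - K) / K)) with hC
  have hC0 : 0 < C := by
    have : 0 < L - K := by linarith
    positivity
  have hCE : C ≤ E / 2 := (min_le_right _ _).trans (min_le_left _ _)
  have hCp : (2 * K) ^ p * C ≤ E / 2 := by
    have : C ≤ E / 2 / (2 * K) ^ p := min_le_left _ _
    rwa [le_div_iff₀' (by positivity)] at this
  have hCL : (1 + C) * K ≤ L := by
    have : C ≤ (L - K) / K := (min_le_right _ _).trans (min_le_right _ _)
    rw [le_div_iff₀ hK0] at this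
    linarith
  have hκC : κ * C ≤ C := mul_le_of_le_one_left hC0.le hκ1.le
  have hEr : E ≤ r := (min_le_left _ _).trans (min_le_left _ _)
  have hEδ : E ≤ δ := (min_le_left _ _).trans (min_le_right _ _)
  have hEρ : E ≤ ρ := (min_le_right _ _).trans (min_le_left _ _)
  have hEη : E ≤ η₁ := (min_le_right _ _).trans (min_le_right _ _)
  refine ⟨κ * C, by positivity, fun Ψ hΨ => ?_⟩
  have hη0 : 0 ≤ κ * C := by positivity
  have hup : ∀ ξ x y, dist (Ψ.fib ξ x) (Ψ.fib ξ y) ≤ L * dist x y := fun ξ x y =>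
    calc _ ≤ (1 + κ * C) * (K * dist x y) := (hΨ.le_mul ξ x y).trans (by gcongr; exact hφK' _ _ _)
      _ ≤ (1 + C) * (K * dist x y) := by gcongr
      _ ≤ L * dist x y := by rw [← mul_assoc]; gcongr
  have hlow : ∀ ξ x y, dist x y ≤ L * dist (Ψ.fib ξ x) (Ψ.fib ξ y) := fun ξ x y =>
    calc _ ≤ K * ((1 + κ * C) * dist (Ψ.fib ξ x) (Ψ.fib ξ y)) :=
          (hφK (ξ 0) x y).trans (by gcongr; exact hΨ.mul_le ξ x y)
      _ ≤ K * ((1 + C) * dist (Ψ.fib ξ x) (Ψ.fib ξ y)) := by gcongr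
      _ = (1 + C) * K * dist (Ψ.fib ξ x) (Ψ.fib ξ y) := by ring
      _ ≤ L * dist (Ψ.fib ξ x) (Ψ.fib ξ y) := by gcongr
  have hLC : L * ν ^ α * C + κ * C ≤ C := by rw [hκ]; linarith
  obtain ⟨θ, hθa, hθr, horb⟩ := H₁ Ψ (hΨ.toC0Close.mono hν (by linarith)) hup _ hxp a
  have hs1 : ∀ ξ ξ' : Seq (k + l), C * seqDist ν ξ ξ' ^ α ≤ C := fun ξ ξ' =>
    mul_le_of_le_one_right hC0.le
      (Real.rpow_le_one (seqDist_nonneg hν _ _) (seqDist_le_one hν hν1 _ _) hα)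
  -- for every `N`, a point that follows the wanted orbit up to time `p + N`
  have hN : ∀ N : ℕ, ∃ P : Seq (k + l) × M,
      (∀ i : ℤ, i < 0 ∨ p ≤ i → P.1 i ∈ range (Fin.castAdd (n := k) l)) ∧
      (∀ i : ℕ, ((Ψ.map ^ (-(i : ℤ))) P).2 ∈ closure Dcs) ∧
      ∀ m : ℕ, m ≤ N → ((Ψ.map ^ ((p + m : ℕ) : ℤ)) P).2 ∈ closure Dcu := by
    intro N
    -- The height of the followed orbit at time `N`. Its constant disk, pulled back `j` times,
    -- passes through the orbit at time `N - j`, and the Hölder bound keeps the whole disk within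
    -- `C` of that point.
    set w := ((Ψ.map ^ (N : ℤ)) (θ, (φ a)^[p] x)).2 with hw
    have hhol : ∀ (j m : ℕ), j + m = N →
        HolderOnStable ν α C (((shift (k + l)) ^ (m : ℤ)) θ) (Ψ.pullback^[j] fun _ => w) := by
      intro j m hjm
      have := holderOnStable_pullback_iterate hν hν1 hα hL0.le hC0.le hlow hΨ.holder hLC
        (((shift (k + l)) ^ (N : ℤ)) θ) w j
      rwa [← Equiv.Perm.mul_apply, ← zpow_add, ← hjm, Nat.cast_add, neg_add_cancel_left] at this
    have hval : ∀ (j m : ℕ), j + m = N → (Ψ.pullback^[j] fun _ => w) (((shift (k + l)) ^ (m : ℤ)) θ)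
        = ((Ψ.map ^ (m : ℤ)) (θ, (φ a)^[p] x)).2 := by
      intro j m hjm
      have h1 := map_zpow_pullback_iterate Ψ (fun _ => w) j (((shift (k + l)) ^ (m : ℤ)) θ)
      have h2 : (Ψ.map ^ (j : ℤ)) ((Ψ.map ^ (m : ℤ)) (θ, (φ a)^[p] x)) =
          (((shift (k + l)) ^ (j : ℤ)) (((shift (k + l)) ^ (m : ℤ)) θ), w) := by
        refine Prod.ext ?_ ?_
        · rw [map_zpow_fst, map_zpow_fst]
        · rw [← map_zpow_add, ← Nat.cast_add, hjm]
      exact congrArg Prod.snd ((Ψ.map ^ (j : ℤ)).injective (h1.trans h2.symm))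
    have hnear : ∀ (j m : ℕ), j + m = N → ∀ ξ ∈ stableSeq (((shift (k + l)) ^ (m : ℤ)) θ),
        dist ((Ψ.map ^ (m : ℤ)) (θ, (φ a)^[p] x)).2 ((Ψ.pullback^[j] fun _ => w) ξ) ≤ C := by
      intro j m hjm ξ hξ
      rw [← hval j m hjm]
      exact (hhol j m hjm _ (mem_stableSeq_self _) _ hξ).trans (hs1 _ _)
    have hdisk := dist_pullback_iterate_le hΨ.toC0Close hK hφK hκC hθa
      (h := Ψ.pullback^[N] fun _ => w)
      (fun ξ hξ => by simpa using hnear N 0 rfl ξ (by simpa using hξ)) p le_rfl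
    -- Splitting the `p + N` pullbacks at `j` reads off the `j`-th forward image of a point of the
    -- final disk.
    have hcomp : ∀ j : ℕ, j ≤ p + N → Ψ.pullback^[p] (Ψ.pullback^[N] fun _ => w) =
        Ψ.pullback^[j] (Ψ.pullback^[p + N - j] fun _ => w) := by
      intro j hj
      rw [← Function.iterate_add_apply, ← Function.iterate_add_apply]
      rw [Nat.add_sub_cancel' hj]
    set h := Ψ.pullback^[p] (Ψ.pullback^[N] fun _ => w) with hh
    have hHol : HolderOnStable ν α C (((shift (k + l)) ^ (-(p : ℤ))) θ) h := by
      have := holderOnStable_pullback_iterate hν hν1 hα hL0.le hC0.le hlow hΨ.holder hLC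
        (((shift (k + l)) ^ (N : ℤ)) θ) w (p + N)
      rw [Function.iterate_add_apply] at this
      rw [← Equiv.Perm.mul_apply, ← zpow_add] at this
      convert this using 4
      push_cast; ring
    rw [Nat.sub_self] at hdisk
    have hrange : ∀ ξ ∈ stableSeq (((shift (k + l)) ^ (-(p : ℤ))) θ), h ξ ∈ Bcs ∧
        dist x (h ξ) < δ := by
      intro ξ hξ
      have h1 : dist x (h ξ) ≤ E / 2 := (hdisk ξ hξ).trans hCp
      exact ⟨hball_r (by rw [Metric.mem_ball, dist_comm]; linarith), by linarith⟩
    have hν1' : ν ^ α ≤ 1 := Real.rpow_le_one hν.le hν1.le hα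
    obtain ⟨ξ, hξ, hsym, hback⟩ := exists_backward_orbit (Ψ := Ψ)
      (ι := Fin.castAdd (n := k) l) (δ := δ) (L := L) (c := κ * C) (B := Bcs) hν hν1 hα hL0 hη0
      (by
        intro z hz
        obtain ⟨i, hi⟩ := hcovδ z (subset_closure hz)
        refine ⟨i, fun ξ hξ w hw => hi (Ψ.fib ξ) (fun x _ => ?_) w hw⟩
        have := hΨ.dist_le ξ x
        simp only [oneStep, hξ] at this
        linarith)
      (fun ξ _ u v _ _ => by simpa using hlow ξ ((Ψ.fib ξ).symm u) ((Ψ.fib ξ).symm v))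
      (fun ξ ζ h0 x _ => (hΨ.holder.2 ξ ζ h0 x (by simp)).2)
      (by
        have h1 : κ * C * ν ^ α ≤ κ * δ := by
          calc _ ≤ κ * C * 1 := by gcongr
            _ ≤ κ * δ := by rw [mul_one]; gcongr; linarith
        rw [hκ] at h1 ⊢
        linarith)
      ⟨⟨x, hx, hrange⟩, C, hC0.le, hHol, by
        have : C * ν ^ α ≤ C := mul_le_of_le_one_right hC0.le hν1'
        linarith⟩
    refine ⟨(ξ, h ξ), fun i hi => ?_, fun i => subset_closure (hBDcs (hback i)), fun m hm => ?_⟩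
    · rcases hi with hi | hi
      · have := hsym (-i - 1).toNat
        rw [Int.toNat_of_nonneg (by omega), show -(-i - 1) - 1 = i by ring] at this
        exact this
      · rw [show (ξ, h ξ).1 i = ξ i from rfl, hξ i (by omega), shift_zpow_apply]
        exact hθr _ (by omega)
    · rw [hcomp (p + m) (by omega), map_zpow_pullback_iterate]
      have e : p + N - (p + m) = N - m := by omega
      rw [e]
      have h1 := hnear (N - m) m (by omega) (((shift (k + l)) ^ ((p + m : ℕ) : ℤ)) ξ) (by
        intro i hi
        rw [shift_zpow_apply, hξ _ (by omega), shift_zpow_apply, shift_zpow_apply]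
        congr 1; push_cast; ring)
      refine subset_closure (hthick (Metric.mem_thickening_iff.2
        ⟨_, subset_closure (horb m), ?_⟩))
      rw [dist_comm]
      linarith
  choose P hP₁ hP₂ hP₃ using hN
  -- All requirements on `P N` are closed, and each fixed time is covered for large `N`, so a limit
  -- along a free ultrafilter satisfies them all.
  let G : Ultrafilter ℕ := hyperfilter ℕ
  have hG : ∀ m : ℕ, ∀ᶠ N in (G : Filter ℕ), m ≤ N := fun m =>
    (eventually_ge_atTop m).filter_mono (Nat.hyperfilter_le_atTop)
  have hlim : Tendsto P G (𝓝 (G.map P).lim) := (G.map P).le_nhds_lim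
  set Q := (G.map P).lim
  have hQsym : ∀ i : ℤ, i < 0 ∨ p ≤ i → Q.1 i ∈ range (Fin.castAdd (n := k) l) := fun i hi =>
    (isClosed_discrete _).mem_of_tendsto
      (((continuous_apply i).tendsto _).comp ((continuous_fst.tendsto Q).comp hlim))
      (Eventually.of_forall fun N => hP₁ N i hi)
  have hmap : ∀ n : ℤ, Tendsto (fun N => ((Ψ.map ^ n) (P N)).2) G (𝓝 ((Ψ.map ^ n) Q).2) :=
    fun n => (continuous_snd.tendsto _).comp (((Ψ.continuous_map_zpow n).tendsto Q).comp hlim)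
  refine ⟨Q, mem_unstableSet_subMaxInv hν hν1 Ψ 0 fun n hn => ⟨?_, hQsym n (Or.inl hn)⟩,
    mem_stableSet_subMaxInv hν hν1 Ψ p fun n hn => ⟨?_, hQsym n (Or.inr hn)⟩⟩
  · refine isClosed_closure.mem_of_tendsto (hmap n) (Eventually.of_forall fun N => ?_)
    have := hP₂ N (-n).toNat
    rwa [Int.toNat_of_nonneg (by omega), neg_neg] at this
  · refine isClosed_closure.mem_of_tendsto (hmap n) ?_
    filter_upwards [hG (n - p).toNat] with N hN
    have := hP₃ N (n - p).toNat hN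
    rwa [Nat.cast_add, Int.toNat_of_nonneg (by omega), add_sub_cancel] at this

end Heteroclinic

end SkewProduct

/-! ### Riemannian distance: mean value inequality and connected balls. -/

section Paths

variable (n : ℕ) {M : Type*} [MetricSpace M] [ChartedSpace (EuclideanSpace ℝ (Fin n)) M]
  [RiemannianBundle (fun x : M => TangentSpace (𝓡 n) x)] [IsRiemannianManifold (𝓡 n) M]

theorem exists_path_of_dist_lt {x y : M} {r : ℝ} (h : dist x y < r) :
    ∃ c : ℝ → M, c 0 = x ∧ c 1 = y ∧ ContMDiff 𝓘(ℝ, ℝ) (𝓡 n) 1 c ∧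
      Manifold.pathELength (𝓡 n) c 0 1 < ENNReal.ofReal r := by
  have h1 : Manifold.riemannianEDist (𝓡 n) x y < ENNReal.ofReal r := by
    rw [← IsRiemannianManifold.out (I := 𝓡 n) x y, edist_dist]
    exact (ENNReal.ofReal_lt_ofReal_iff_of_nonneg dist_nonneg).2 h
  obtain ⟨c, h0, h1, hc, hl, -⟩ :=
    Manifold.exists_lt_locally_constant_of_riemannianEDist_lt h1 zero_lt_one
  exact ⟨c, h0, h1, hc, hl⟩

variable {n} in
theorem dist_le_mul_of_norm_mfderiv_le {h : M → M} (hh : ContMDiff (𝓡 n) (𝓡 n) 1 h) {K : ℝ}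
    (hK : 0 < K)
    (hd : ∀ (x : M) (v : TangentSpace (𝓡 n) x), ‖mfderiv (𝓡 n) (𝓡 n) h x v‖ ≤ K * ‖v‖) (x y : M) :
    dist (h x) (h y) ≤ K * dist x y := by
  rw [← div_le_iff₀' hK]
  refine le_of_forall_gt_imp_ge_of_dense fun r hr => ?_
  rw [div_le_iff₀' hK]
  have hr0 : 0 ≤ r := dist_nonneg.trans hr.le
  obtain ⟨c, h0, h1, hc, hl⟩ := exists_path_of_dist_lt n hr
  have h2 : edist (h x) (h y) ≤ Manifold.pathELength (𝓡 n) (h ∘ c) 0 1 := by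
    rw [IsRiemannianManifold.out (I := 𝓡 n) (h x) (h y)]
    exact Manifold.riemannianEDist_le_pathELength (hh.comp hc).contMDiffOn (by simp [h0])
      (by simp [h1]) zero_le_one
  have h3 : Manifold.pathELength (𝓡 n) (h ∘ c) 0 1 ≤
      ENNReal.ofReal K * Manifold.pathELength (𝓡 n) c 0 1 := by
    rw [Manifold.pathELength_eq_lintegral_mfderiv_Icc,
      Manifold.pathELength_eq_lintegral_mfderiv_Icc,
      ← MeasureTheory.lintegral_const_mul' _ _ ENNReal.ofReal_ne_top]
    refine MeasureTheory.lintegral_mono fun t => ?_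
    have e : mfderiv 𝓘(ℝ, ℝ) (𝓡 n) (h ∘ c) t (1 : ℝ) =
        mfderiv (𝓡 n) (𝓡 n) h (c t) (mfderiv 𝓘(ℝ, ℝ) (𝓡 n) c t (1 : ℝ)) := by
      rw [mfderiv_comp t (hh.mdifferentiable one_ne_zero _) (hc.mdifferentiable one_ne_zero _)]
      rfl
    have h4 := hd (c t) (mfderiv 𝓘(ℝ, ℝ) (𝓡 n) c t (1 : ℝ))
    rw [← e] at h4
    have h5 := ENNReal.ofReal_le_ofReal h4
    rw [ENNReal.ofReal_mul hK.le, ofReal_norm, ofReal_norm] at h5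
    exact h5
  have h6 : edist (h x) (h y) ≤ ENNReal.ofReal (K * r) := by
    rw [ENNReal.ofReal_mul hK.le]
    exact (h2.trans h3).trans (by gcongr)
  rw [edist_dist] at h6
  exact (ENNReal.ofReal_le_ofReal_iff (by positivity)).1 h6

end Paths

/-- A path from the centre of length less than `r` stays in the ball, since each initial piece is no
longer than the whole. -/
theorem isPreconnected_metricBall (n : ℕ) {M : Type*} [MetricSpace M]
    [ChartedSpace (EuclideanSpace ℝ (Fin n)) M]
    [RiemannianBundle (fun x : M => TangentSpace (𝓡 n) x)] [IsRiemannianManifold (𝓡 n) M]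
    (z : M) (r : ℝ) : IsPreconnected (Metric.ball z r) := by
  refine isPreconnected_of_forall z fun y hy => ?_
  obtain ⟨c, h0, h1, hc, hl⟩ := exists_path_of_dist_lt n (Metric.mem_ball'.1 hy)
  refine ⟨c '' Icc 0 1, ?_, ⟨0, by simp, h0⟩, ⟨1, by simp, h1⟩,
    isPreconnected_Icc.image _ hc.continuous.continuousOn⟩
  rintro _ ⟨t, ht, rfl⟩
  have h2 : edist z (c t) < ENNReal.ofReal r := by
    rw [IsRiemannianManifold.out (I := 𝓡 n) z (c t)]
    exact ((Manifold.riemannianEDist_le_pathELength hc.contMDiffOn h0 rfl ht.1).trans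
      (Manifold.pathELength_mono le_rfl ht.2)).trans_lt hl
  rw [edist_dist] at h2
  rw [Metric.mem_ball']
  exact (ENNReal.ofReal_lt_ofReal_iff_of_nonneg dist_nonneg).1 h2

/-! ### Derivatives seen through an embedding, and distortion of norms. -/

section Derivative

theorem exists_mul_norm_le_of_injective {E F : Type*} [NormedAddCommGroup E] [NormedSpace ℝ E]
    [NormedAddCommGroup F] [NormedSpace ℝ F] [FiniteDimensional ℝ E] (f : E →L[ℝ] F)
    (hf : Function.Injective f) : ∃ c > 0, ∀ v, c * ‖v‖ ≤ ‖f v‖ := by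
  obtain ⟨K, hK, h⟩ := LinearMap.exists_antilipschitzWith f.toLinearMap (LinearMap.ker_eq_bot.2 hf)
  refine ⟨(K : ℝ)⁻¹, by positivity, fun v => ?_⟩
  have := h.le_mul_dist v 0
  simp only [map_zero, dist_zero_right] at this
  rw [inv_mul_le_iff₀ (by exact_mod_cast hK)]
  exact this

variable {n N : ℕ} {M : Type*} [MetricSpace M] [ChartedSpace (EuclideanSpace ℝ (Fin n)) M]

/-- The derivative of a map into a Euclidean space. -/
noncomputable def euclDeriv {N : ℕ} (u : M → EuclideanSpace ℝ (Fin N)) (x : M) :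
    TangentSpace (𝓡 n) x →L[ℝ] EuclideanSpace ℝ (Fin N) := mfderiv (𝓡 n) (𝓡 N) u x

theorem euclDeriv_comp {e : M → EuclideanSpace ℝ (Fin N)} (he : ContMDiff (𝓡 n) (𝓡 N) 1 e)
    {f : M → M} (hf : ContMDiff (𝓡 n) (𝓡 n) 1 f) (x : M) (v : TangentSpace (𝓡 n) x) :
    euclDeriv (e ∘ f) x v = euclDeriv e (f x) (mfderiv (𝓡 n) (𝓡 n) f x v) := by
  unfold euclDeriv
  rw [mfderiv_comp x (he.mdifferentiable one_ne_zero _) (hf.mdifferentiable one_ne_zero _)]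
  rfl

end Derivative

section NormDeriv

variable {n : ℕ} {M : Type*} [MetricSpace M] [ChartedSpace (EuclideanSpace ℝ (Fin n)) M]
  [RiemannianBundle (fun x : M => TangentSpace (𝓡 n) x)]

/-- The derivatives of `f` and `g` at `x` distort norms by the same factor up to `1 + ε`. -/
def NormDerivClose (ε : ℝ) (f g : M → M) (x : M) : Prop :=
  ∀ v : TangentSpace (𝓡 n) x,
    ‖mfderiv (𝓡 n) (𝓡 n) g x v‖ ≤ (1 + ε) * ‖mfderiv (𝓡 n) (𝓡 n) f x v‖ ∧
    ‖mfderiv (𝓡 n) (𝓡 n) f x v‖ ≤ (1 + ε) * ‖mfderiv (𝓡 n) (𝓡 n) g x v‖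

theorem NormDerivClose.symm {ε : ℝ} {f g : M → M} {x : M} (h : NormDerivClose (n := n) ε f g x) :
    NormDerivClose (n := n) ε g f x := fun v => ⟨(h v).2, (h v).1⟩

/-- The derivative of `g ∘ f.symm` has norm at most `1 + ε`; the mean value inequality is applied
between `f x` and `f y`. The comparison is global on `M`, so Lipschitz bounds transfer to arbitrary
subsets without convexity. -/
theorem NormDerivClose.dist_le [IsRiemannianManifold (𝓡 n) M] {ε : ℝ} (hε : 0 ≤ ε) {f : M ≃ₜ M}
    {g : M → M} (hf : ContMDiff (𝓡 n) (𝓡 n) 1 f) (hf' : ContMDiff (𝓡 n) (𝓡 n) 1 f.symm)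
    (hg : ContMDiff (𝓡 n) (𝓡 n) 1 g) (h : ∀ x, NormDerivClose (n := n) ε f g x) (x y : M) :
    dist (g x) (g y) ≤ (1 + ε) * dist (f x) (f y) := by
  have := dist_le_mul_of_norm_mfderiv_le (hg.comp hf') (K := 1 + ε) (by linarith) (fun z w => by
    have hd : MDifferentiableAt (𝓡 n) (𝓡 n) f.symm z := hf'.mdifferentiable one_ne_zero z
    have e1 : mfderiv (𝓡 n) (𝓡 n) (g ∘ f.symm) z w =
        mfderiv (𝓡 n) (𝓡 n) g (f.symm z) (mfderiv (𝓡 n) (𝓡 n) f.symm z w) := by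
      rw [mfderiv_comp z (hg.mdifferentiable one_ne_zero _) hd]; rfl
    have e2 : mfderiv (𝓡 n) (𝓡 n) (f ∘ f.symm) z w =
        mfderiv (𝓡 n) (𝓡 n) f (f.symm z) (mfderiv (𝓡 n) (𝓡 n) f.symm z w) := by
      rw [mfderiv_comp z (hf.mdifferentiable one_ne_zero _) hd]; rfl
    have e3 : ‖mfderiv (𝓡 n) (𝓡 n) (f ∘ f.symm) z w‖ = ‖w‖ := by
      rw [f.self_comp_symm, mfderiv_id]; rfl
    have := (h (f.symm z) (mfderiv (𝓡 n) (𝓡 n) f.symm z w)).1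
    rw [← e1, ← e2] at this
    exact this.trans_eq (by rw [← e3])) (f x) (f y)
  simpa using this

theorem exists_mul_norm_le_euclDeriv {N : ℕ} {u : M → EuclideanSpace ℝ (Fin N)} {x : M}
    (hx : Function.Injective (mfderiv (𝓡 n) (𝓡 N) u x)) :
    ∃ c > 0, ∀ v : TangentSpace (𝓡 n) x, c * ‖v‖ ≤ ‖euclDeriv u x v‖ := by
  have : FiniteDimensional ℝ (TangentSpace (𝓡 n) x) :=
    inferInstanceAs (FiniteDimensional ℝ (EuclideanSpace ℝ (Fin n)))
  have hinj : Function.Injective (euclDeriv (n := n) u x) := hx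
  exact exists_mul_norm_le_of_injective (euclDeriv (n := n) u x) hinj

end NormDeriv

/-! ### Closeness through the embedding implies Riemannian closeness. -/

section Riemannian

variable {n N : ℕ} {M : Type*} [MetricSpace M] 
    [ChartedSpace (EuclideanSpace ℝ (Fin n)) M] [IsManifold (𝓡 n) ∞ M]
    [RiemannianBundle (fun x : M => TangentSpace (𝓡 n) x)]
    [IsContMDiffRiemannianBundle (𝓡 n) ∞ (EuclideanSpace ℝ (Fin n))
      (fun x : M => TangentSpace (𝓡 n) x)]

variable (n M) in
theorem isContinuousRiemannianBundle_tangentSpace :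
    IsContinuousRiemannianBundle (EuclideanSpace ℝ (Fin n))
      (fun x : M => TangentSpace (𝓡 n) x) := by
  obtain ⟨g, hg, h⟩ := IsContMDiffRiemannianBundle.exists_contMDiff (IB := 𝓡 n) (n := ∞)
    (F := EuclideanSpace ℝ (Fin n)) (E := fun x : M => TangentSpace (𝓡 n) x)
  exact ⟨g, hg.continuous, h⟩

/-- The vector `w` is `v` carried to `x` in the trivialization of the tangent bundle at `x`.
Continuity of the metric makes this nearly isometric, and continuity of the derivative of `u` in
these coordinates gives the last estimate. -/
theorem exists_derivative_comparison (u : M → EuclideanSpace ℝ (Fin N))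
    (hu : ContMDiff (𝓡 n) (𝓡 N) 1 u) (x : M) {ε : ℝ} (hε : 0 < ε) :
    ∀ᶠ y in 𝓝 x, ∀ v : TangentSpace (𝓡 n) y, ∃ w : TangentSpace (𝓡 n) x,
      ‖w‖ ≤ (1 + ε) * ‖v‖ ∧ ‖v‖ ≤ (1 + ε) * ‖w‖ ∧
      ‖euclDeriv u y v - euclDeriv u x w‖ ≤ ε * ‖v‖ := by
  have := isContinuousRiemannianBundle_tangentSpace n M
  set T := trivializationAt (EuclideanSpace ℝ (Fin n)) (fun x : M => TangentSpace (𝓡 n) x) x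
  have h1 := eventually_norm_symmL_trivializationAt_self_comp_lt (EuclideanSpace ℝ (Fin n))
    (fun x : M => TangentSpace (𝓡 n) x) x (r := 1 + ε) (by linarith)
  have h2 := eventually_norm_symmL_trivializationAt_comp_self_lt (EuclideanSpace ℝ (Fin n))
    (fun x : M => TangentSpace (𝓡 n) x) x (r := 1 + ε) (by linarith)
  obtain ⟨C, hC, h3⟩ := eventually_norm_trivializationAt_lt (EuclideanSpace ℝ (Fin n))
    (fun x : M => TangentSpace (𝓡 n) x) x
  have h4 : ∀ᶠ y in 𝓝 x, y ∈ T.baseSet :=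
    T.open_baseSet.mem_nhds (FiberBundle.mem_baseSet_trivializationAt' x)
  have hcont := (ContMDiffAt.mfderiv_const (m := 0) (hu x) le_rfl).continuousAt
  have hF : ∀ y ∈ T.baseSet, ∀ a : EuclideanSpace ℝ (Fin n),
      inTangentCoordinates (𝓡 n) (𝓡 N) id u (mfderiv (𝓡 n) (𝓡 N) u) x y a =
        euclDeriv u y (T.symmL ℝ y a) := by
    intro y hy a
    have e : inTangentCoordinates (𝓡 n) (𝓡 N) id u (mfderiv (𝓡 n) (𝓡 N) u) x y a =
        (trivializationAt (EuclideanSpace ℝ (Fin N)) (TangentSpace (𝓡 N)) (u x)).continuousLinearMapAt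
          ℝ (u y) (mfderiv (𝓡 n) (𝓡 N) u y (T.symmL ℝ y a)) := rfl
    rw [e, TangentBundle.continuousLinearMapAt_model_space]
    rfl
  have h5 := Metric.tendsto_nhds.1 hcont (ε / C) (by positivity)
  filter_upwards [h1, h2, h3, h4, h5] with y hy1 hy2 hy3 hy4 hy5 v
  have hx : x ∈ T.baseSet := FiberBundle.mem_baseSet_trivializationAt' x
  set a := T.continuousLinearMapAt ℝ y v with ha
  have hav : T.symmL ℝ y a = v := T.symmL_continuousLinearMapAt hy4 v
  set w := T.symmL ℝ x a with hw
  have haw : T.continuousLinearMapAt ℝ x w = a := T.continuousLinearMapAt_symmL hx a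
  refine ⟨w, ?_, ?_, ?_⟩
  · exact (ContinuousLinearMap.le_of_opNorm_le _ hy1.le v)
  · have := (ContinuousLinearMap.le_of_opNorm_le _ hy2.le w)
    rwa [ContinuousLinearMap.comp_apply, haw, hav] at this
  · rw [dist_eq_norm] at hy5
    have h6 := ContinuousLinearMap.le_of_opNorm_le _ hy5.le a
    rw [sub_apply, hF y hy4, hF x hx, hav] at h6
    refine h6.trans ?_
    have h7 : ‖a‖ ≤ C * ‖v‖ := ContinuousLinearMap.le_of_opNorm_le _ hy3.le v
    calc _ ≤ ε / C * (C * ‖v‖) := by gcongr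
      _ = _ := by field_simp

theorem eventually_euclDeriv_bounds {u : M → EuclideanSpace ℝ (Fin N)}
    (hu : ContMDiff (𝓡 n) (𝓡 N) 1 u) {x : M}
    (hx : Function.Injective (mfderiv (𝓡 n) (𝓡 N) u x)) :
    ∃ c > 0, ∃ C > 0, ∀ᶠ y in 𝓝 x, ∀ v : TangentSpace (𝓡 n) y,
      c * ‖v‖ ≤ ‖euclDeriv u y v‖ ∧ ‖euclDeriv u y v‖ ≤ C * ‖v‖ := by
  obtain ⟨c, hc, H⟩ := exists_mul_norm_le_euclDeriv hx
  refine ⟨c / 4, by positivity, 2 * ‖euclDeriv (n := n) u x‖ + 1, by positivity, ?_⟩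
  filter_upwards [exists_derivative_comparison u hu x (ε := min 1 (c / 4)) (by positivity)]
    with y hy v
  obtain ⟨w, h1, h2, h3⟩ := hy v
  have hε1 : min 1 (c / 4) ≤ 1 := min_le_left _ _
  have hε2 : min 1 (c / 4) ≤ c / 4 := min_le_right _ _
  have h4 : ‖w‖ ≤ 2 * ‖v‖ := h1.trans (by gcongr; linarith)
  have h5 : ‖v‖ ≤ 2 * ‖w‖ := h2.trans (by gcongr; linarith)
  have h6 := H w
  have h7 := (euclDeriv u x).le_opNorm w
  have h8 : min 1 (c / 4) * ‖v‖ ≤ 1 * ‖v‖ := by gcongr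
  have h9 : min 1 (c / 4) * ‖v‖ ≤ c / 4 * ‖v‖ := by gcongr
  have h10 := norm_sub_norm_le (euclDeriv u x w) (euclDeriv u y v)
  have h11 := norm_sub_norm_le (euclDeriv u y v) (euclDeriv u x w)
  rw [norm_sub_rev] at h10
  constructor
  · have : c * ‖v‖ ≤ c * (2 * ‖w‖) := by gcongr
    linarith
  · have : ‖euclDeriv (n := n) u x‖ * ‖w‖ ≤ ‖euclDeriv (n := n) u x‖ * (2 * ‖v‖) := by gcongr
    linarith

/-- Both vectors are carried to `x`, where injectivity of the derivative of `e` bounds the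
difference of their copies by that of their images. -/
theorem exists_norm_le_of_euclDeriv_sub_le {e : M → EuclideanSpace ℝ (Fin N)}
    (he : ContMDiff (𝓡 n) (𝓡 N) 1 e) {x : M}
    (hx : Function.Injective (mfderiv (𝓡 n) (𝓡 N) e x)) {ε : ℝ} (hε : 0 < ε) :
    ∃ σ > 0, ∃ r > 0, ∀ q q' : M, dist q x < r → dist q' x < r →
      ∀ (v : TangentSpace (𝓡 n) q) (v' : TangentSpace (𝓡 n) q'),
        ‖euclDeriv e q v - euclDeriv e q' v'‖ ≤ σ * ‖v‖ → ‖v'‖ ≤ (1 + ε) * ‖v‖ := by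
  obtain ⟨c, hc, H⟩ := exists_mul_norm_le_euclDeriv hx
  -- The estimate for `‖v'‖` contains `‖v'‖` on the right with coefficient `(1 + t) * t / c`. The
  -- conditions on `t` allow absorbing it and leave a ratio below `1 + ε`.
  obtain ⟨t, ht0, ht1, ht2⟩ : ∃ t : ℝ, 0 < t ∧ 0 < 1 - (1 + t) * t / c ∧
      (1 + t) * ((1 + t) + 2 * t / c) < (1 + ε) * (1 - (1 + t) * t / c) := by
    have h1 : ∀ᶠ t : ℝ in 𝓝[>] 0, 0 < t := self_mem_nhdsWithin
    have h2 : ∀ᶠ t : ℝ in 𝓝[>] 0, 0 < 1 - (1 + t) * t / c := by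
      have : ContinuousAt (fun t : ℝ => 1 - (1 + t) * t / c) 0 := by fun_prop
      exact (this.eventually_const_lt (by simp)).filter_mono nhdsWithin_le_nhds
    have h3 : ∀ᶠ t : ℝ in 𝓝[>] 0,
        (1 + t) * ((1 + t) + 2 * t / c) < (1 + ε) * (1 - (1 + t) * t / c) := by
      have ha : ContinuousAt (fun t : ℝ => (1 + t) * ((1 + t) + 2 * t / c)) 0 := by fun_prop
      have hb : ContinuousAt (fun t : ℝ => (1 + ε) * (1 - (1 + t) * t / c)) 0 := by fun_prop
      exact (ha.eventually_lt hb (by simpa using hε)).filter_mono nhdsWithin_le_nhds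
    exact (h1.and (h2.and h3)).exists
  obtain ⟨r, hr, Hr⟩ := Metric.eventually_nhds_iff.1 (exists_derivative_comparison e he x ht0)
  refine ⟨t, ht0, r, hr, fun q q' hq hq' v v' hvv => ?_⟩
  obtain ⟨w, h1, h2, h3⟩ := Hr hq v
  obtain ⟨w', h1', h2', h3'⟩ := Hr hq' v'
  have h4 : c * ‖w' - w‖ ≤ 2 * t * ‖v‖ + t * ‖v'‖ := by
    refine (H _).trans ?_
    have e1 : euclDeriv e x (w' - w) = (euclDeriv e q v - euclDeriv e x w) -
        (euclDeriv e q' v' - euclDeriv e x w') - (euclDeriv e q v - euclDeriv e q' v') := by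
      rw [map_sub]; abel
    rw [e1]
    have := norm_sub_le ((euclDeriv e q v - euclDeriv e x w) -
        (euclDeriv e q' v' - euclDeriv e x w')) (euclDeriv e q v - euclDeriv e q' v')
    have := norm_sub_le (euclDeriv e q v - euclDeriv e x w)
        (euclDeriv e q' v' - euclDeriv e x w')
    linarith
  have h5 : ‖w' - w‖ ≤ (2 * t * ‖v‖ + t * ‖v'‖) / c := by rwa [le_div_iff₀' hc]
  have h6 : ‖w'‖ ≤ (1 + t) * ‖v‖ + (2 * t * ‖v‖ + t * ‖v'‖) / c := by
    have := norm_le_norm_add_norm_sub' w' w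
    linarith
  have h7 : ‖v'‖ * (1 - (1 + t) * t / c) ≤ (1 + t) * ((1 + t) + 2 * t / c) * ‖v‖ := by
    have : ‖v'‖ ≤ (1 + t) * ((1 + t) * ‖v‖ + (2 * t * ‖v‖ + t * ‖v'‖) / c) :=
      h2'.trans (by gcongr)
    have e2 : (1 + t) * ((1 + t) * ‖v‖ + (2 * t * ‖v‖ + t * ‖v'‖) / c) =
      (1 + t) * ((1 + t) + 2 * t / c) * ‖v‖ + ‖v'‖ * ((1 + t) * t / c) := by ring
    linarith
  have h8 : (1 + t) * ((1 + t) + 2 * t / c) * ‖v‖ ≤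
      (1 + ε) * (1 - (1 + t) * t / c) * ‖v‖ := by gcongr
  refine le_of_mul_le_mul_right ?_ ht1
  linarith

/-- The preceding comparison needs an error relative to the image vectors. The lower bound for `e ∘
f` and the upper bound for `e` convert `η * ‖v‖` into one. -/
theorem eventually_normDerivClose {e : M → EuclideanSpace ℝ (Fin N)}
    (he : ContMDiff (𝓡 n) (𝓡 N) 1 e)
    (hinj : ∀ x, Function.Injective (mfderiv (𝓡 n) (𝓡 N) e x)) (f : M ≃ₘ^1⟮𝓡 n, 𝓡 n⟯ M) (p : M)
    {ε : ℝ} (hε : 0 < ε) :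
    ∃ η > 0, ∀ᶠ x in 𝓝 p, ∀ g : M → M, ContMDiff (𝓡 n) (𝓡 n) 1 g → dist (f x) (g x) ≤ η →
      (∀ v : TangentSpace (𝓡 n) x, ‖euclDeriv (e ∘ f) x v - euclDeriv (e ∘ g) x v‖ ≤ η * ‖v‖) →
      NormDerivClose (n := n) ε f g x := by
  have hfinj : Function.Injective (mfderiv (𝓡 n) (𝓡 N) (e ∘ f) p) := by
    rw [mfderiv_comp p (he.mdifferentiable one_ne_zero _)
      (f.contMDiff.mdifferentiable one_ne_zero _)]
    exact (hinj (f p)).comp (f.mfderivToContinuousLinearEquiv one_ne_zero p).injective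
  obtain ⟨c, hc, _, _, H₁⟩ := eventually_euclDeriv_bounds (he.comp f.contMDiff) hfinj
  obtain ⟨_, _, C, hC, H₂⟩ := eventually_euclDeriv_bounds he (hinj (f p))
  obtain ⟨σ, hσ, r, hr, H₃⟩ := exists_norm_le_of_euclDeriv_sub_le he (hinj (f p)) hε
  obtain ⟨r', hr', H₂'⟩ := Metric.eventually_nhds_iff.1 H₂
  have hf : ∀ᶠ x in 𝓝 p, dist (f x) (f p) < min r r' / 2 :=
    Metric.tendsto_nhds.1 f.continuous.continuousAt _ (by positivity)
  -- The terms keep `g x` in both balls around `f p`, leave `e ∘ g` half the lower bound `c`, and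
  -- make the error at most `σ` times either image norm.
  refine ⟨min (min r r' / 4) (min (c / 2) (σ * c / (2 * C))), by positivity, ?_⟩
  filter_upwards [H₁, hf] with x hx₁ hx₂ g hg hfg hder v
  set η := min (min r r' / 4) (min (c / 2) (σ * c / (2 * C)))
  have hη1 : η ≤ min r r' / 4 := min_le_left _ _
  have hη2 : η ≤ c / 2 := (min_le_right _ _).trans (min_le_left _ _)
  have hη3 : η * (2 * C) ≤ σ * c := by
    have : η ≤ σ * c / (2 * C) := (min_le_right _ _).trans (min_le_right _ _)
    rwa [le_div_iff₀ (by positivity)] at this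
  have hm1 : min r r' ≤ r := min_le_left _ _
  have hm2 : min r r' ≤ r' := min_le_right _ _
  have hm0 : 0 < min r r' := lt_min hr hr'
  have hgx : dist (g x) (f p) < min r r' := by
    have := dist_triangle_left (g x) (f p) (f x)
    linarith
  have hfx : dist (f x) (f p) < min r r' := by linarith
  have h1 := hder v
  have h2 := (hx₁ v).1
  rw [euclDeriv_comp he f.contMDiff, euclDeriv_comp he hg] at h1
  rw [euclDeriv_comp he f.contMDiff] at h2
  have h3 := (H₂' (hfx.trans_le hm2) (mfderiv (𝓡 n) (𝓡 n) f x v)).2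
  have h4 := (H₂' (hgx.trans_le hm2) (mfderiv (𝓡 n) (𝓡 n) g x v)).2
  set a := ‖mfderiv (𝓡 n) (𝓡 n) f x v‖
  set b := ‖mfderiv (𝓡 n) (𝓡 n) g x v‖
  have ha : η * ‖v‖ ≤ σ * a := by
    have : η * (2 * C) * ‖v‖ ≤ σ * c * ‖v‖ := by gcongr
    have : σ * (c * ‖v‖) ≤ σ * (C * a) := mul_le_mul_of_nonneg_left (h2.trans h3) hσ.le
    have : 0 ≤ σ * C * a := by positivity
    refine le_of_mul_le_mul_right ?_ (show 0 < 2 * C by positivity)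
    linarith
  have hb : η * ‖v‖ ≤ σ * b := by
    have h5 := norm_le_norm_add_norm_sub (euclDeriv e (g x) (mfderiv (𝓡 n) (𝓡 n) g x v))
      (euclDeriv e (f x) (mfderiv (𝓡 n) (𝓡 n) f x v))
    have : η * ‖v‖ ≤ c / 2 * ‖v‖ := by gcongr
    have h6 : c * ‖v‖ ≤ 2 * C * b := by
      rw [norm_sub_rev] at h5
      linarith
    have : η * (2 * C) * ‖v‖ ≤ σ * c * ‖v‖ := by gcongr
    have : σ * (c * ‖v‖) ≤ σ * (2 * C * b) := by gcongr
    refine le_of_mul_le_mul_right ?_ (show 0 < 2 * C by positivity)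
    linarith
  refine ⟨H₃ _ _ (hfx.trans_le hm1) (hgx.trans_le hm1) _ _ (h1.trans ha),
    H₃ _ _ (hgx.trans_le hm1) (hfx.trans_le hm1) _ _ ?_⟩
  rw [norm_sub_rev]
  exact h1.trans hb

theorem exists_normDerivClose [CompactSpace M] {e : M → EuclideanSpace ℝ (Fin N)}
    (he : ContMDiff (𝓡 n) (𝓡 N) 1 e)
    (hinj : ∀ x, Function.Injective (mfderiv (𝓡 n) (𝓡 N) e x)) (f : M ≃ₘ^1⟮𝓡 n, 𝓡 n⟯ M)
    {ε : ℝ} (hε : 0 < ε) :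
    ∃ η > 0, ∀ g : M → M, ContMDiff (𝓡 n) (𝓡 n) 1 g → (∀ x, dist (f x) (g x) ≤ η) →
      (∀ (x : M) (v : TangentSpace (𝓡 n) x),
        ‖euclDeriv (e ∘ f) x v - euclDeriv (e ∘ g) x v‖ ≤ η * ‖v‖) →
      ∀ x, NormDerivClose (n := n) ε f g x := by
  have := isCompact_univ (X := M).induction_on (p := fun s => ∃ η > 0, ∀ x ∈ s, ∀ g : M → M,
    ContMDiff (𝓡 n) (𝓡 n) 1 g → dist (f x) (g x) ≤ η →
      (∀ v : TangentSpace (𝓡 n) x, ‖euclDeriv (e ∘ f) x v - euclDeriv (e ∘ g) x v‖ ≤ η * ‖v‖) →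
      NormDerivClose (n := n) ε f g x)
    ⟨1, one_pos, by simp⟩
    (fun s t hst ⟨η, hη, H⟩ => ⟨η, hη, fun x hx => H x (hst hx)⟩)
    (by
      rintro s t ⟨η, hη, H⟩ ⟨η', hη', H'⟩
      refine ⟨min η η', lt_min hη hη', ?_⟩
      rintro x (hx | hx) g hg hd hder
      · exact H x hx g hg (hd.trans (min_le_left _ _)) fun v => (hder v).trans
          (mul_le_mul_of_nonneg_right (min_le_left _ _) (norm_nonneg _))
      · exact H' x hx g hg (hd.trans (min_le_right _ _)) fun v => (hder v).trans
          (mul_le_mul_of_nonneg_right (min_le_right _ _) (norm_nonneg _)))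
    (by
      intro p _
      obtain ⟨η, hη, H⟩ := eventually_normDerivClose he hinj f p hε
      exact ⟨_, mem_nhdsWithin_of_mem_nhds H, η, hη, fun x hx => hx⟩)
  obtain ⟨η, hη, H⟩ := this
  exact ⟨η, hη, fun g hg hd hder x => H x (mem_univ _) g hg (hd x) (hder x)⟩

end Riemannian

namespace SkewProduct

/-! ### From `C^1` perturbations to bi-Lipschitz closeness. -/

section Perturbation

variable {d : ℕ} {M : Type*} [MetricSpace M] {ν α : ℝ}

theorem C0Close.self_oneStep (hν : 0 < ν) (φ : Fin d → M ≃ₜ M) {η : ℝ} (hη : 0 ≤ η) :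
    C0Close ν α η (oneStep φ) (oneStep φ) :=
  ⟨fun ξ x => by simpa using hη, isHolderBound_oneStep hν φ hη⟩

theorem LipClose.self_oneStep (hν : 0 < ν) (φ : Fin d → M ≃ₜ M) {η : ℝ} (hη : 0 ≤ η) :
    LipClose ν α η (oneStep φ) (oneStep φ) where
  toC0Close := C0Close.self_oneStep hν φ hη
  le_mul _ _ _ := le_mul_of_one_le_left dist_nonneg (by linarith)
  mul_le _ _ _ := le_mul_of_one_le_left dist_nonneg (by linarith)

theorem LipClose.mono (hν : 0 < ν) {η η' : ℝ} {Φ Ψ : SkewProduct d M} (h : LipClose ν α η Φ Ψ)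
    (hη : η ≤ η') : LipClose ν α η' Φ Ψ where
  toC0Close := h.toC0Close.mono hν hη
  le_mul ξ x y := (h.le_mul ξ x y).trans (by gcongr)
  mul_le ξ x y := (h.mul_le ξ x y).trans (by gcongr)

theorem LipClose.isBiLipschitzOn {η lam bet : ℝ} {Φ Ψ : SkewProduct d M}
    (h : LipClose ν α η Φ Ψ) {ξ : Seq d} {s : Set M} (hs : IsBiLipschitzOn lam bet (Φ.fib ξ) s) :
    IsBiLipschitzOn (lam / (1 + η)) (bet * (1 + η)) (Ψ.fib ξ) s := by
  intro x hx y hy hxy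
  have h0 : 0 < 1 + η := by linarith [h.nonneg]
  obtain ⟨h1, h2⟩ := hs x hx y hy hxy
  constructor
  · rw [div_mul_eq_mul_div, div_lt_iff₀' h0]
    exact h1.trans_le (h.mul_le ξ x y)
  · calc _ ≤ _ := h.le_mul ξ x y
      _ < (1 + η) * (bet * dist x y) := by gcongr
      _ = _ := by ring

theorem exists_pos_forall_le {k : ℕ} {η : Fin k → ℝ} (hη : ∀ i, 0 < η i) :
    ∃ t > 0, ∀ i, t ≤ η i := by
  have h : ∀ᶠ t : ℝ in 𝓝[>] 0, ∀ i, t ≤ η i :=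
    eventually_all.2 fun i => nhdsWithin_le_nhds (Iic_mem_nhds (hη i))
  have h0 : ∀ᶠ t : ℝ in 𝓝[>] (0 : ℝ), 0 < t := self_mem_nhdsWithin
  exact (h0.and h).exists

variable {n : ℕ} [CompactSpace M]
    [ChartedSpace (EuclideanSpace ℝ (Fin n)) M] [IsManifold (𝓡 n) ∞ M]
    [RiemannianBundle (fun x : M => TangentSpace (𝓡 n) x)]
    [IsContMDiffRiemannianBundle (𝓡 n) ∞ (EuclideanSpace ℝ (Fin n))
      (fun x : M => TangentSpace (𝓡 n) x)]
    [IsRiemannianManifold (𝓡 n) M]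

/-- A one-step map has finitely many fibre maps, so one threshold works for all `ξ`. The reverse
Lipschitz comparison exchanges the roles of the two maps. -/
theorem exists_lipClose_of_s1Dist_lt (hν : 0 < ν) (φ : Fin d → (M ≃ₘ^1⟮𝓡 n, 𝓡 n⟯ M)) {N : ℕ}
    {e : M → EuclideanSpace ℝ (Fin N)} (he : IsSmoothEmb n e) {η : ℝ} (hη : 0 < η) :
    ∃ ε > (0 : ℝ≥0∞), ∀ Ψ : SkewProduct d M, (∃ lam bet, MemS n 1 ν α lam bet univ Ψ) →
      s1Dist n e ν α (oneStep fun i => (φ i).toHomeomorph) Ψ < ε →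
      LipClose ν α η (oneStep fun i => (φ i).toHomeomorph) Ψ := by
  have he1 : ContMDiff (𝓡 n) (𝓡 N) 1 e := he.1.of_le (by norm_cast)
  choose t ht H using fun i => exists_normDerivClose he1 he.2.2 (φ i) hη
  obtain ⟨t₀, ht₀, htt⟩ := exists_pos_forall_le ht
  set ε := min η t₀ with hε
  have hε0 : 0 < ε := lt_min hη ht₀
  refine ⟨ENNReal.ofReal ε, by simpa using hε0, fun Ψ ⟨lam, bet, hΨ⟩ hd => ?_⟩
  set Φ := oneStep fun i => (φ i).toHomeomorph
  have hc1 : ∀ ξ, c1Dist n e (Φ.fib ξ) (Ψ.fib ξ) < ENNReal.ofReal ε := fun ξ =>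
    ((le_iSup (fun ξ => c1Dist n e (Φ.fib ξ) (Ψ.fib ξ)) ξ).trans le_self_add).trans_lt hd
  have hdist : ∀ ξ x, dist (Φ.fib ξ x) (Ψ.fib ξ x) ≤ ε := by
    intro ξ x
    have h1 : edist (Φ.fib ξ x) (Ψ.fib ξ x) ≤ c1Dist n e (Φ.fib ξ) (Ψ.fib ξ) :=
      (le_iSup₂ (f := fun x (_ : x ∈ closure (univ : Set M)) => edist (Φ.fib ξ x) (Ψ.fib ξ x)) x
        (by simp)).trans le_self_add
    have h2 := (h1.trans_lt (hc1 ξ)).le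
    rw [edist_dist] at h2
    exact (ENNReal.ofReal_le_ofReal_iff hε0.le).1 h2
  have hder₁ : ∀ ξ (x : M) (v : TangentSpace (𝓡 n) x), ‖v‖ ≤ 1 →
      ‖euclDeriv (e ∘ Φ.fib ξ) x v - euclDeriv (e ∘ Ψ.fib ξ) x v‖ ≤ ε := by
    intro ξ x v hv
    have h1 : edist (embDeriv n e (Φ.fib ξ) x v) (embDeriv n e (Ψ.fib ξ) x v) ≤
        c1Dist n e (Φ.fib ξ) (Ψ.fib ξ) := by
      refine le_trans ?_ le_add_self
      exact le_iSup_of_le x (le_iSup_of_le v (le_iSup_of_le hv le_rfl))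
    have h2 := (h1.trans_lt (hc1 ξ)).le
    rw [edist_dist, ENNReal.ofReal_le_ofReal_iff hε0.le, dist_eq_norm] at h2
    exact h2
  have hder : ∀ ξ (x : M) (v : TangentSpace (𝓡 n) x),
      ‖euclDeriv (e ∘ Φ.fib ξ) x v - euclDeriv (e ∘ Ψ.fib ξ) x v‖ ≤ ε * ‖v‖ := by
    intro ξ x v
    rcases eq_or_ne v 0 with rfl | hv
    · simp
    have hv' : 0 < ‖v‖ := norm_pos_iff.2 hv
    have h1 := hder₁ ξ x (‖v‖⁻¹ • v) (by rw [norm_smul]; simp [hv'.ne'])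
    rw [map_smul, map_smul, ← smul_sub, norm_smul, norm_inv, norm_norm, inv_mul_le_iff₀ hv'] at h1
    linarith
  have hclose : ∀ ξ x, NormDerivClose (n := n) η (Φ.fib ξ) (Ψ.fib ξ) x := fun ξ =>
    H (ξ 0) (Ψ.fib ξ) (hΨ.contMDiff ξ)
      (fun x => (hdist ξ x).trans ((min_le_right _ _).trans (htt _)))
      (fun x v => (hder ξ x v).trans
        (mul_le_mul_of_nonneg_right ((min_le_right _ _).trans (htt _)) (norm_nonneg _)))
  have hhol : ∃ C < ε, IsHolderBound ν α univ Ψ C := by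
    have h1 : ENNReal.ofReal |holderConst ν α univ Φ - holderConst ν α univ Ψ| <
      ENNReal.ofReal ε := lt_of_le_of_lt le_add_self hd
    rw [holderConst_oneStep hν, zero_sub, abs_neg, abs_of_nonneg (holderConst_nonneg _)] at h1
    obtain ⟨C, hC, hC'⟩ :=
      exists_lt_of_csInf_lt hΨ.holder ((ENNReal.ofReal_lt_ofReal_iff hε0).1 h1)
    exact ⟨C, hC', hC⟩
  obtain ⟨C, hC, hCb⟩ := hhol
  have hεη : ε ≤ η := min_le_left _ _
  exact
    { dist_le := fun ξ x => (hdist ξ x).trans hεη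
      holder := hCb.mono hν Subset.rfl (hC.le.trans hεη)
      le_mul := fun ξ => NormDerivClose.dist_le hη.le (φ (ξ 0)).contMDiff (φ (ξ 0)).symm.contMDiff
        (hΨ.contMDiff ξ) (hclose ξ)
      mul_le := fun ξ => NormDerivClose.dist_le hη.le (hΨ.contMDiff ξ) (hΨ.contMDiff_symm ξ)
        (φ (ξ 0)).contMDiff (fun x => (hclose ξ x).symm) }

end Perturbation

end SkewProduct

end SymbolicSkew

/-! ### The theorem. -/

open SymbolicSkew SkewProduct in
theorem theorem5p2 {n : ℕ} {M : Type*} [MetricSpace M] [CompactSpace M]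
    [ChartedSpace (EuclideanSpace ℝ (Fin n)) M] [IsManifold (𝓡 n) ∞ M]
    [RiemannianBundle (fun x : M => TangentSpace (𝓡 n) x)]
    [IsContMDiffRiemannianBundle (𝓡 n) ∞ (EuclideanSpace ℝ (Fin n))
      (fun x : M => TangentSpace (𝓡 n) x)]
    [IsRiemannianManifold (𝓡 n) M]
    (ν α γ γhat lamcs betcs lamcu betcu : ℝ) (hν0 : 0 < ν) (hν1 : ν < 1)
    (h1 : ν ^ α < γ) (h2 : γ ≤ lamcs) (h3 : lamcs < betcs) (h4 : betcs < 1)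
    (h5 : 1 < lamcu) (h6 : lamcu < betcu) (h7 : betcu ≤ γhat⁻¹) (h8 : γhat⁻¹ < ν ^ (-α))
    (k : ℕ) (φ : Fin (k + 2) → (M ≃ₘ^1⟮𝓡 n, 𝓡 n⟯ M))
    (hφ : ∀ i, IsBiLipschitzOn γ γhat⁻¹ (φ i) univ)
    (Dcs Dcu Bcs Bcu : Set M) (hDcs : IsOpen Dcs) (hDcu : IsOpen Dcu) (hD : Disjoint Dcs Dcu)
    (hScs : MemS n 1 ν α lamcs betcs Dcs
      (oneStep fun i : Fin k => (φ (Fin.castAdd 2 i)).toHomeomorph))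
    (hScu : MemS n 1 ν α lamcu betcu Dcu
      (oneStep fun i : Fin k => (φ (Fin.castAdd 2 i)).toHomeomorph))
    (hBcs : IsOpen Bcs) (hBcu : IsOpen Bcu) (hBDcs : Bcs ⊆ Dcs) (hBDcu : Bcu ⊆ Dcu)
    (hcovcs : closure Bcs ⊆ ⋃ i : Fin k, φ (Fin.castAdd 2 i) '' Bcs)
    (hcovcu : closure Bcu ⊆ ⋃ i : Fin k, (φ (Fin.castAdd 2 i)).symm '' Bcu)
    (x y : M) (hx : x ∈ Bcs) (hy : y ∈ Bcu) (p q : ℕ) (hp : 0 < p) (hq : 0 < q)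
    (hxp : (φ (Fin.natAdd k 0))^[p] x ∈ Bcu) (hyq : (φ (Fin.natAdd k 1))^[q] y ∈ Bcs) :
    MemPHS n 1 ν α γ γhat⁻¹ (oneStep fun i => (φ i).toHomeomorph) ∧
    IsCsBlender n ν α lamcs betcs Dcs
      (oneStep fun i : Fin k => (φ (Fin.castAdd 2 i)).toHomeomorph) Bcs ∧
    IsCuBlender n ν α lamcu betcu Dcu
      (oneStep fun i : Fin k => (φ (Fin.castAdd 2 i)).toHomeomorph) Bcu ∧
    HasRobustSymbolicCycle n ν α (oneStep fun i => (φ i).toHomeomorph)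
      (subMaxInv (k := k) (l := 2) Dcs) (subMaxInv (k := k) (l := 2) Dcu) ∧
    ForSmallPerturbations n ν α (oneStep fun i => (φ i).toHomeomorph) (fun Ψ =>
      (∃ lam bet, IsCsBlender n ν α lam bet Dcs (Ψ.restrict (k := k) (l := 2)) Bcs) ∧
      (∃ lam bet, IsCuBlender n ν α lam bet Dcu (Ψ.restrict (k := k) (l := 2)) Bcu)) := by
  have hνα : 0 < ν ^ α := Real.rpow_pos_of_pos hν0 α
  have hα : 0 < α := by
    refine hScs.alpha_nonneg.lt_of_ne fun h => ?_
    rw [← h, Real.rpow_zero] at h1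
    linarith
  have hα1 : α ≤ 1 := hScs.alpha_le_one
  have hk : 2 ≤ k := hScs.two_le
  have hγ : 0 < γ := hνα.trans h1
  have hγh : 1 < γhat⁻¹ := by linarith
  have hball := isPreconnected_metricBall n (M := M)
  let f : Fin k → M ≃ₜ M := fun i => (φ (Fin.castAdd 2 i)).toHomeomorph
  let g : Fin (k + 2) → M ≃ₜ M := fun i => (φ i).toHomeomorph
  have hfcs : ∀ i, f i '' closure Dcs ⊆ Dcs := fun i => hScs.contracting h4 fun _ => i
  have hfcu : ∀ i, closure Dcu ⊆ f i '' Dcu := fun i => hScu.expanding h5 fun _ => i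
  -- A common Lipschitz constant for the maps and their inverses; the outer inequalities on `γ` and
  -- `γhat` amount to `K * ν ^ α < 1`.
  set K : ℝ := max γ⁻¹ γhat⁻¹
  have hK : 1 ≤ K := hγh.le.trans (le_max_right _ _)
  have hKν : K * ν ^ α < 1 := by
    rw [max_mul_of_nonneg _ _ hνα.le, max_lt_iff, inv_mul_lt_iff₀ hγ, mul_one]
    refine ⟨h1, ?_⟩
    rwa [Real.rpow_neg hν0.le, ← one_div (ν ^ α), lt_div_iff₀ hνα] at h8
  have hgK : ∀ i x y, dist x y ≤ K * dist (g i x) (g i y) := by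
    intro i x y
    rcases eq_or_ne x y with rfl | hxy
    · simp
    · have := (hφ i x (mem_univ _) y (mem_univ _) hxy).1.le
      rw [← le_inv_mul_iff₀ hγ] at this
      exact this.trans (mul_le_mul_of_nonneg_right (le_max_left _ _) dist_nonneg)
  have hgK' : ∀ i x y, dist (g i x) (g i y) ≤ K * dist x y := by
    intro i x y
    rcases eq_or_ne x y with rfl | hxy
    · simp
    · exact (hφ i x (mem_univ _) y (mem_univ _) hxy).2.le.trans
        (mul_le_mul_of_nonneg_right (le_max_right _ _) dist_nonneg)
  obtain ⟨lam₀, hlam, hlam'⟩ := exists_between h1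
  obtain ⟨bet₀, hbet, hbet'⟩ := exists_between h8
  obtain ⟨η₁, hη₁, H₁⟩ := exists_isCsBlender (n := n) hball hν0 hν1 hα hα1 hk hlam hDcs hBcs
    ⟨x, hx⟩ hBDcs hcovcs hfcs
  obtain ⟨η₂, hη₂, H₂⟩ := exists_isCuBlender (n := n) hball hν0 hν1 hα hα1 hk
    (by linarith) hbet' hK (fun i => hgK (Fin.castAdd 2 i)) hDcu hBcu ⟨y, hy⟩ hBDcu hcovcu hfcu
  obtain ⟨η₃, hη₃, H₃⟩ := exists_stableSet_inter_unstableSet (α := α) hν0 hν1 (by omega : 0 < k)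
    (φ := g) hK hgK hDcs hDcu hfcs hfcu (hBDcu hy) (hBDcs hyq)
  obtain ⟨η₄, hη₄, H₄⟩ := exists_unstableSet_inter_stableSet hν0 hν1 hα.le hball (φ := g) hK hKν
    hgK hgK' hDcu hfcu hBcs hBcu hBDcs hBDcu hcovcs hcovcu hx hxp
  -- Perturbed constants are `lam / (1 + η₅)` and `bet * (1 + η₅)`; the gaps left by `lam₀`, `bet₀`
  -- and `1` accommodate them.
  obtain ⟨η₅, hη₅, hη₅cs, hη₅cs', hη₅cu, hη₅cu'⟩ : ∃ η > 0, lam₀ ≤ lamcs / (1 + η) ∧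
      betcs * (1 + η) < 1 ∧ 1 < lamcu / (1 + η) ∧ betcu * (1 + η) ≤ bet₀ := by
    have hc : Tendsto (fun η : ℝ => 1 + η) (𝓝[>] 0) (𝓝 1) := by
      have : Continuous fun η : ℝ => 1 + η := by fun_prop
      simpa using (this.tendsto 0).mono_left nhdsWithin_le_nhds
    have hm : ∀ c : ℝ, Tendsto (fun η : ℝ => c * (1 + η)) (𝓝[>] 0) (𝓝 c) := fun c => by
      simpa using hc.const_mul c
    have hd : ∀ c : ℝ, Tendsto (fun η : ℝ => c / (1 + η)) (𝓝[>] 0) (𝓝 c) := fun c => by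
      have h := (tendsto_const_nhds (x := c) (f := 𝓝[>] (0 : ℝ))).div hc one_ne_zero
      rwa [div_one] at h
    have h0 : ∀ᶠ η : ℝ in 𝓝[>] (0 : ℝ), 0 < η := self_mem_nhdsWithin
    exact (h0.and (((hd lamcs).eventually_const_le (hlam'.trans_le h2)).and
      (((hm betcs).eventually_lt_const h4).and (((hd lamcu).eventually_const_lt h5).and
      ((hm betcu).eventually_le_const (h7.trans_lt hbet)))))).exists
  have hcycle : ∀ Ψ : SkewProduct (k + 2) M, LipClose ν α (min η₃ η₄) (oneStep g) Ψ →
      HasSymbolicCycle ν Ψ (subMaxInv (k := k) (l := 2) Dcs Ψ)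
        (subMaxInv (k := k) (l := 2) Dcu Ψ) := fun Ψ hΨ =>
    ⟨map_image_subMaxInv Ψ Dcs, map_image_subMaxInv Ψ Dcu,
      H₃ Ψ (hΨ.toC0Close.mono hν0 (min_le_left _ _)), H₄ Ψ (hΨ.mono hν0 (min_le_right _ _))⟩
  refine ⟨⟨?_, h1, by linarith, hγh, h8⟩,
    (H₁ _ (C0Close.self_oneStep hν0 _ hη₁.le)).2 _ _ (hlam'.le.trans h2) h3 h4 hScs.lipschitz,
    H₂ _ (C0Close.self_oneStep hν0 _ hη₂.le) _ _ (h7.trans hbet.le) h6 h5 hScu.lipschitz,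
    ⟨hcycle _ (LipClose.self_oneStep hν0 _ (by positivity)), fun N e he => ?_⟩, fun N e he => ?_⟩
  · exact
      { two_le := by omega
        alpha_nonneg := hα.le
        alpha_le_one := hα1
        lam_pos := hγ
        lam_lt_bet := by linarith
        isOpen := isOpen_univ
        isBounded := isCompact_univ.isBounded
        contMDiff := fun ξ => (φ (ξ 0)).contMDiff
        contMDiff_symm := fun ξ => (φ (ξ 0)).symm.contMDiff
        lipschitz := fun ξ => by rw [closure_univ]; exact hφ (ξ 0)
        holder := ⟨0, isHolderBound_oneStep hν0 _ le_rfl⟩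
        contracting := fun h => by linarith
        expanding := fun h => by linarith }
  · obtain ⟨ε, hε, H⟩ := exists_lipClose_of_s1Dist_lt (α := α) hν0 φ he
      (show 0 < min η₃ η₄ by positivity)
    exact ⟨ε, hε, fun Ψ hΨ hd => hcycle Ψ (H Ψ hΨ hd)⟩
  · obtain ⟨ε, hε, H⟩ := exists_lipClose_of_s1Dist_lt (α := α) hν0 φ he
      (show 0 < min η₅ (min η₁ η₂) by positivity)
    refine ⟨ε, hε, fun Ψ hΨ hd => ?_⟩
    have hl := H Ψ hΨ hd
    have hl₅ := hl.mono hν0 (min_le_left _ _)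
    have hl₁ := hl.toC0Close.mono hν0 ((min_le_right _ _).trans (min_le_left _ _))
    have hl₂ := hl.toC0Close.mono hν0 ((min_le_right _ _).trans (min_le_right _ _))
    have hlt : ∀ {l b : ℝ}, 0 < l → l < b → l / (1 + η₅) < b * (1 + η₅) := fun {l b} h0 hlb =>
      calc l / (1 + η₅) ≤ l := div_le_self h0.le (by linarith)
        _ < b := hlb
        _ ≤ b * (1 + η₅) := le_mul_of_one_le_right (h0.trans hlb).le (by linarith)
    exact ⟨⟨_, _, (H₁ _ hl₁.restrict).2 _ _ hη₅cs (hlt (by linarith) h3) hη₅cs'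
        fun ξ => hl₅.isBiLipschitzOn (ξ := inclSeq k 2 ξ) (hScs.lipschitz ξ)⟩,
      ⟨_, _, H₂ _ hl₂.restrict _ _ hη₅cu' (hlt (by linarith) h6) hη₅cu
        fun ξ => hl₅.isBiLipschitzOn (ξ := inclSeq k 2 ξ) (hScu.lipschitz ξ)⟩⟩
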